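/- **Theorem (Soundness of normalization by evaluation for $\lambda^{\to\square}$).** Consider the simply typed modal $\lambda$-calculus $\lambda^{\to\square}$ with types $S,T ::= B \mid \square T \mid S \longrightarrow T$ and terms $s,t ::= x \mid \mathtt{box}\,t \mid \mathtt{unbox}_n\,t \mid \lambda x.t \mid t\,s$ (terms up to $\alpha$-equivalence). Typing $\vec\Gamma\vdash t:T$ is relative to a non-empty stack $\vec\Gamma=\epsilon;\Gamma_1;\dots;\Gamma_k$ of contexts; $|\vec\Gamma|=k$, and $\vec\Gamma|n$ is $\vec\Gamma$ without its $n<|\vec\Gamma|$ topmost contexts. Fix one of the four modal systems, given by its set $U$ of unbox levels: $U=\{1\}$ ($K$), $\{0,1\}$ ($T$), $\mathbb N^+$ ($K4$) or $\mathbb N$ ($S4$). The typing rules are: $\vec\Gamma;\Gamma\vdash x:T$ if $x:T\in\Gamma$; if $\vec\Gamma;\cdot\vdash t:T$ then $\vec\Gamma\vdash\mathtt{box}\,t:\square T$; if $n\in U$, $n<|\vec\Gamma|$ and $\vec\Gamma|n\vdash t:\square T$ then $\vec\Gamma\vdash\mathtt{unbox}_n\,t:T$; and the usual rules for $\lambda$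 and application. Judgmental equivalence $\vec\Gamma\vdash t\approx t':T$ is the least symmetric, transitive relation that is closed under the congruence rules of all term formers (including $x\approx x$) and contains, for well-typed terms, $$\mathtt{unbox}_n(\mathtt{box}\,t)\approx t\{n/0\}\ (n\in U),\quad (\lambda x.t)\,s\approx t[s/x],\quad t\approx\mathtt{box}(\mathtt{unbox}_1\,t)\ (t:\square T),\quad t\approx\lambda x.(t\,x)\ (t:S\longrightarrow T),$$ where the modal transformation $t\{n/0\}$ moves $t$ from $\vec\Gamma;\cdot$ to $\vec\Gamma;\vec\Delta$ with $|\vec\Delta|=n$, that is, $t\{n/0\}=t[\vec{\mathrm{id}};\Uparrow^n()]$. *Substitutions.* A K-substitution $\vec\sigma$ is $\varepsilon;\sigma$ or $\vec\sigma;\Uparrow^n\sigma$, where a local substitution $\sigma$ gives a term for each variable of one context. If $\vec\sigma=\vec\sigma';\Uparrow^{m_n}\sigma_n;\dots;\Uparrow^{m_1}\sigma_1$, put $\vec\sigma|n=\vec\sigma'$ and $L(\vec\sigma,n)=m_1+\dots+m_n$. It acts on terms by $x[\vec\sigma]=\sigma(x)$ for the topmost $\sigma$, $(\mathtt{box}\,t)[\vec\sigma]=\mathtt{box}(t[\vec\sigma;\Uparrow^1()])$,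 $(\mathtt{unbox}_n t)[\vec\sigma]=\mathtt{unbox}_{L(\vec\sigma,n)}(t[\vec\sigma|n])$, and as usual on $\lambda$ and application. Composition is $(\varepsilon;\sigma)\circ\vec\delta=\varepsilon;\sigma[\vec\delta]$ and $(\vec\sigma;\Uparrow^n\sigma)\circ\vec\delta=(\vec\sigma\circ(\vec\delta|n));\Uparrow^{L(\vec\delta,n)}\sigma[\vec\delta]$, and $\vec{\mathrm{id}}=\varepsilon;\mathrm{id};\Uparrow^1\mathrm{id};\dots;\Uparrow^1\mathrm{id}$. K-weakenings $\vec\gamma:\vec\Gamma\Rightarrow_w\vec\Delta$ are the K-substitutions generated by the empty one $\epsilon;\cdot\Rightarrow_w\epsilon;\cdot$; by $q(\vec\gamma):\vec\Gamma;(\Gamma,x:T)\Rightarrow_w\vec\Delta;(\Delta,x:T)$ and $p(\vec\gamma):\vec\Gamma;(\Gamma,x:T)\Rightarrow_w\vec\Delta;\Delta$ for $\vec\gamma:\vec\Gamma;\Gamma\Rightarrow_w\vec\Delta;\Delta$ (extension by $x\mapsto x$, respectively weakening by $x$); and by $\vec\gamma;\Uparrow^n:\vec\Gamma\Rightarrow_w\vec\Delta;\cdot$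 for $\vec\gamma:\vec\Gamma|n\Rightarrow_w\vec\Delta$, $n\in U$, $n<|\vec\Gamma|$. Stacks and K-weakenings form a category $\mathcal W$. *Model.* Neutral forms $v::=x\mid v\,w\mid\mathtt{unbox}_n v$ and normal forms $w::=v\mid\mathtt{box}\,w\mid\lambda x.w$ of type $T$ give presheaves $\mathsf{Ne}\,T$, $\mathsf{Nf}\,T$ on $\mathcal W$. Types are interpreted as presheaves by $[\![B]\!]=\mathsf{Ne}\,B$, $[\![\square T]\!]_{\vec\Gamma}=[\![T]\!]_{\vec\Gamma;\cdot}$, and $[\![S\longrightarrow T]\!]$ is the presheaf exponential, whose elements over $\vec\Gamma$ are the families of functions $[\![S]\!]_{\vec\Delta}\to[\![T]\!]_{\vec\Delta}$, indexed by $\vec\Delta\Rightarrow_w\vec\Gamma$ and natural in $\vec\Delta$. Contexts are interpreted as products, and stacks by $[\![\epsilon;\Gamma]\!]=\hat\top\,\hat\times\,[\![\Gamma]\!]$ and $[\![\vec\Gamma;\Gamma]\!]_{\vec\Delta}=\bigl(\sum_{n\in U,\,n<|\vec\Delta|}[\![\vec\Gamma]\!]_{\vec\Delta|n}\bigr)\times[\![\Gamma]\!]_{\vec\Delta}$.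 Truncations $\vec\rho|n$ and offsets $L(\vec\rho,n)$ of environments $\vec\rho\in[\![\vec\Gamma]\!]_{\vec\Delta}$ are defined as for K-substitutions. A derivation of $\vec\Gamma\vdash t:T$ evaluates to a natural transformation $[\![t]\!]:[\![\vec\Gamma]\!]\Rightarrow[\![T]\!]$: a variable is looked up in the topmost component, and $$[\![\mathtt{box}\,t]\!]_{\vec\Delta}(\vec\rho)=[\![t]\!]_{\vec\Delta;\cdot}((1,\vec\rho),*),\qquad [\![\mathtt{unbox}_n t]\!]_{\vec\Delta}(\vec\rho)=[\![t]\!]_{\vec\Delta|m}(\vec\rho|n)[\vec{\mathrm{id}};\Uparrow^m],\ m=L(\vec\rho,n),$$ $$[\![\lambda x.t]\!]_{\vec\Delta}(\vec\rho)(\vec\gamma,a)=[\![t]\!](\pi,(\rho,a))\text{ with }(\pi,\rho)=\vec\rho[\vec\gamma],\qquad [\![t\,s]\!]_{\vec\Delta}(\vec\rho)=[\![t]\!]_{\vec\Delta}(\vec\rho)(\vec{\mathrm{id}},[\![s]\!]_{\vec\Delta}(\vec\rho)).$$ Reification $\downarrow^T:[\![T]\!]\Rightarrow\mathsf{Nf}\,T$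 and reflection $\uparrow^T:\mathsf{Ne}\,T\Rightarrow[\![T]\!]$ are given by $$\downarrow^B(a)=a,\quad \downarrow^{\square T}_{\vec\Gamma}(a)=\mathtt{box}\downarrow^T_{\vec\Gamma;\cdot}(a),\quad \downarrow^{S\longrightarrow T}_{\vec\Gamma;\Gamma}(a)=\lambda x.\downarrow^T_{\vec\Gamma;(\Gamma,x:S)}\bigl(a(p(\vec{\mathrm{id}}),\uparrow^S(x))\bigr),$$ $$\uparrow^B(v)=v,\quad \uparrow^{\square T}_{\vec\Gamma}(v)=\uparrow^T_{\vec\Gamma;\cdot}(\mathtt{unbox}_1 v),\quad \uparrow^{S\longrightarrow T}(v)(\vec\gamma:\vec\Delta\Rightarrow_w\vec\Gamma,\,a)=\uparrow^T_{\vec\Delta}\bigl(v[\vec\gamma]\,\downarrow^S_{\vec\Delta}(a)\bigr).$$ The identity environment $\uparrow^{\vec\Gamma}\in[\![\vec\Gamma]\!]_{\vec\Gamma}$ is $\uparrow^{\epsilon;\cdot}=(*,*)$, $\uparrow^{\vec\Gamma;\cdot}=((1,\uparrow^{\vec\Gamma}),*)$, $\uparrow^{\vec\Gamma;(\Gamma,x:T)}=(\pi,(\rho,\uparrow^T(x)))$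 with $(\pi,\rho)=\uparrow^{\vec\Gamma;\Gamma}[p(\vec{\mathrm{id}})]$. For a derivation of $\vec\Gamma\vdash t:T$ put $$\mathsf{nbe}^T_{\vec\Gamma}(t)=\ \downarrow^T_{\vec\Gamma}\bigl([\![t]\!]_{\vec\Gamma}(\uparrow^{\vec\Gamma})\bigr)\in\mathsf{Nf}\,T\,\vec\Gamma.$$ **Claim.** In each of the systems $K$, $T$, $K4$, $S4$: if $\vec\Gamma\vdash t:T$, then $\vec\Gamma\vdash t\approx\mathsf{nbe}^T_{\vec\Gamma}(t):T$. -/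

import Mathlib

open CategoryTheory Opposite

namespace LamBox

/-! ### Syntax -/

/-- Types: a base type, `□ T`, and `S ⟶ T`. -/
inductive Ty : Type
  | base : Ty
  | box (T : Ty) : Ty
  | arr (S T : Ty) : Ty

/-- Raw terms, with de Bruijn indices: `var x` is the `x`-th most recent variable of the
current (topmost) context. -/
inductive Exp : Type
  | var (x : ℕ) : Exp
  | box (t : Exp) : Exp
  | unbox (n : ℕ) (t : Exp) : Exp
  | lam (t : Exp) : Exp
  | app (t s : Exp) : Exp

/-- Local contexts; the head of the list is the most recently bound variable. -/
abbrev Ctx : Type := List Ty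

/-- Non-empty context stacks: the topmost (current) context `top`, and the list `below` of the
other contexts, the one directly below `top` first. -/
structure Stack : Type where
  below : List Ctx
  top : Ctx

namespace Stack

/-- `Γ⃗ ; Δ`. -/
def push (Γ : Stack) (Δ : Ctx) : Stack := ⟨Γ.top :: Γ.below, Δ⟩

/-- `Γ⃗ ; (Γ, x : T)` from `Γ⃗ ; Γ`. -/
def bind (Γ : Stack) (T : Ty) : Stack := ⟨Γ.below, T :: Γ.top⟩

/-- The number of contexts in a stack. -/
def size (Γ : Stack) : ℕ := Γ.below.length + 1

/-- Truncation `Γ⃗ | n`: drop the `n` topmost contexts (meaningful for `n < Γ.size` only). -/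
def trunc : Stack → ℕ → Stack
  | Γ, 0 => Γ
  | ⟨[], _⟩, _ + 1 => ⟨[], []⟩
  | ⟨G :: Gs, _⟩, n + 1 => trunc ⟨Gs, G⟩ n

end Stack

/-- The four modal systems. -/
inductive Logic : Type
  | K | T | K4 | S4

/-- The unbox levels of each system. -/
def Logic.UL : Logic → Set ℕ
  | .K => {1}
  | .T => {0, 1}
  | .K4 => {n | 1 ≤ n}
  | .S4 => Set.univ

/-- `HasVar Γ x T`: the variable with index `x` has type `T` in the local context `Γ`. -/
inductive HasVar : Ctx → ℕ → Ty → Type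
  | here {Γ : Ctx} {T : Ty} : HasVar (T :: Γ) 0 T
  | there {Γ : Ctx} {x : ℕ} {S T : Ty} : HasVar Γ x T → HasVar (S :: Γ) (x + 1) T

/-- Typing derivations `Γ⃗ ⊢ t : T`. In the rule for `unbox`, the conclusion lives in a stack of
the form `Γ⃗' ; Δ⃗` with `|Δ⃗| = n` and `Γ⃗'` non-empty; so `n < |Γ⃗|` and `Γ⃗' = Γ⃗ | n`. -/
inductive Typing (L : Logic) : Stack → Exp → Ty → Type
  | var {Γ : Stack} {x : ℕ} {T : Ty} : HasVar Γ.top x T → Typing L Γ (.var x) T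
  | box {Γ : Stack} {t : Exp} {T : Ty} :
      Typing L (Γ.push []) t T → Typing L Γ (.box t) (.box T)
  | unbox {Γ : Stack} {n : ℕ} {t : Exp} {T : Ty} :
      n ∈ L.UL → n < Γ.size → Typing L (Γ.trunc n) t (.box T) → Typing L Γ (.unbox n t) T
  | lam {Γ : Stack} {t : Exp} {S T : Ty} :
      Typing L (Γ.bind S) t T → Typing L Γ (.lam t) (.arr S T)
  | app {Γ : Stack} {t s : Exp} {S T : Ty} :
      Typing L Γ t (.arr S T) → Typing L Γ s S → Typing L Γ (.app t s) T

/-! ### Kripke-style substitutions -/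

/-- Make room for a new variable with index `c` in the context that lies `l` contexts below the
topmost one. -/
def Exp.shift : ℕ → ℕ → Exp → Exp
  | l, c, .var x => if l = 0 ∧ c ≤ x then .var (x + 1) else .var x
  | l, c, .box t => .box (shift (l + 1) c t)
  | l, c, .unbox m t => if m ≤ l then .unbox m (shift (l - m) c t) else .unbox m t
  | l, c, .lam t => .lam (shift l (if l = 0 then c + 1 else c) t)
  | l, c, .app t s => .app (shift l c t) (shift l c s)

/-- Weakening of a term by one new most recent variable of the topmost context. -/
abbrev Exp.wk (t : Exp) : Exp := t.shift 0 0

/-- Raw K-substitutions: `base σ` is `ε ; σ`, and `ext σ⃗ n σ` is `σ⃗ ; ⇑ⁿ σ`. A local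
substitution is the list of the terms for the variables `0, 1, 2, …`. -/
inductive KSub : Type
  | base (σ : List Exp) : KSub
  | ext (s : KSub) (n : ℕ) (σ : List Exp) : KSub

namespace KSub

/-- The topmost local substitution. -/
def top : KSub → List Exp
  | base σ => σ
  | ext _ _ σ => σ

/-- Truncation offset: the sum of the `n` leading offsets. -/
def offset : KSub → ℕ → ℕ
  | _, 0 => 0
  | base _, _ + 1 => 0
  | ext s m _, n + 1 => m + offset s n

/-- Truncation: drop the `n` topmost local substitutions. -/
def trunc : KSub → ℕ → KSub
  | s, 0 => s
  | base _, _ + 1 => base []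
  | ext s _ _, n + 1 => trunc s n

/-- Extend the topmost local substitution with a term for a new most recent variable. -/
def snoc : KSub → Exp → KSub
  | base σ, t => base (t :: σ)
  | ext s n σ, t => ext s n (t :: σ)

/-- The composite of a K-substitution with the weakening of the topmost context of its domain by
one variable. With offset `0` the next local substitution lives in the same context. -/
def weaken : KSub → KSub
  | base σ => base (σ.map Exp.wk)
  | ext s n σ => ext (if n = 0 then weaken s else s) n (σ.map Exp.wk)

/-- The extension of a K-substitution under a binder, `(σ⃗, x/x)`. -/
def lift (s : KSub) : KSub := s.weaken.snoc (.var 0)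

end KSub

/-- The K-substitution operation `t[σ⃗]`. -/
def Exp.sub : Exp → KSub → Exp
  | .var x, s => s.top.getD x (.var x)
  | .box t, s => .box (t.sub (s.ext 1 []))
  | .unbox n t, s => .unbox (s.offset n) (t.sub (s.trunc n))
  | .lam t, s => .lam (t.sub s.lift)
  | .app t u, s => .app (t.sub s) (u.sub s)

namespace KSub

/-- Composition `σ⃗ ∘ δ⃗`. -/
def comp : KSub → KSub → KSub
  | base σ, d => base (σ.map fun t => t.sub d)
  | ext s n σ, d => ext (comp s (d.trunc n)) (d.offset n) (σ.map fun t => t.sub d)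

/-- The local identity substitution on `Γ`. -/
def localId (Γ : Ctx) : List Exp := (List.range Γ.length).map Exp.var

/-- The identity K-substitution with given lower contexts and topmost context. -/
def idAux : List Ctx → Ctx → KSub
  | [], Γ => base (localId Γ)
  | G :: Gs, Γ => ext (idAux Gs G) 1 (localId Γ)

/-- The identity K-substitution `id⃗ = ε ; id ; … ; id`. -/
def id (Γ : Stack) : KSub := idAux Γ.below Γ.top

end KSub

/-- The modal transformation `t{n/0}` of a term in `Γ⃗ ; ·` to a stack `Γ⃗ ; Δ⃗` with `|Δ⃗| = n`,
as the K-substitution `id⃗ ; ⇑ⁿ ()`. -/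
def Exp.modalTrans (Γ : Stack) (n : ℕ) (t : Exp) : Exp := t.sub ((KSub.id Γ).ext n [])

/-- Substitution `t[s/x]` for the most recent variable of the topmost context of `Γ⃗, x : S`. -/
def Exp.subst (Γ : Stack) (s t : Exp) : Exp := t.sub ((KSub.id Γ).snoc s)

/-- Judgmental equivalence `Γ⃗ ⊢ t ≈ t' : T`. -/
inductive TmEquiv (L : Logic) : Stack → Exp → Exp → Ty → Prop
  | symm {Γ : Stack} {s t : Exp} {T : Ty} : TmEquiv L Γ s t T → TmEquiv L Γ t s T
  | trans {Γ : Stack} {s t u : Exp} {T : Ty} :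
      TmEquiv L Γ s t T → TmEquiv L Γ t u T → TmEquiv L Γ s u T
  | var {Γ : Stack} {x : ℕ} {T : Ty} : HasVar Γ.top x T → TmEquiv L Γ (.var x) (.var x) T
  | box {Γ : Stack} {t t' : Exp} {T : Ty} :
      TmEquiv L (Γ.push []) t t' T → TmEquiv L Γ (.box t) (.box t') (.box T)
  | unbox {Γ : Stack} {n : ℕ} {t t' : Exp} {T : Ty} :
      n ∈ L.UL → n < Γ.size → TmEquiv L (Γ.trunc n) t t' (.box T) →
      TmEquiv L Γ (.unbox n t) (.unbox n t') T
  | lam {Γ : Stack} {t t' : Exp} {S T : Ty} :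
      TmEquiv L (Γ.bind S) t t' T → TmEquiv L Γ (.lam t) (.lam t') (.arr S T)
  | app {Γ : Stack} {t t' s s' : Exp} {S T : Ty} :
      TmEquiv L Γ t t' (.arr S T) → TmEquiv L Γ s s' S → TmEquiv L Γ (.app t s) (.app t' s') T
  | box_beta {Γ : Stack} {n : ℕ} {t : Exp} {T : Ty} :
      n ∈ L.UL → n < Γ.size → Typing L ((Γ.trunc n).push []) t T →
      TmEquiv L Γ (.unbox n (.box t)) (t.modalTrans (Γ.trunc n) n) T
  | lam_beta {Γ : Stack} {t s : Exp} {S T : Ty} :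
      Typing L (Γ.bind S) t T → Typing L Γ s S →
      TmEquiv L Γ (.app (.lam t) s) (Exp.subst Γ s t) T
  | box_eta {Γ : Stack} {t : Exp} {T : Ty} :
      Typing L Γ t (.box T) → TmEquiv L Γ t (.box (.unbox 1 t)) (.box T)
  | lam_eta {Γ : Stack} {t : Exp} {S T : Ty} :
      Typing L Γ t (.arr S T) → TmEquiv L Γ t (.lam (.app t.wk (.var 0))) (.arr S T)

mutual
/-- Normal forms. -/
inductive IsNf : Exp → Prop
  | ne {v : Exp} : IsNe v → IsNf v
  | box {w : Exp} : IsNf w → IsNf (.box w)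
  | lam {w : Exp} : IsNf w → IsNf (.lam w)
/-- Neutral forms. -/
inductive IsNe : Exp → Prop
  | var (x : ℕ) : IsNe (.var x)
  | app {v w : Exp} : IsNe v → IsNf w → IsNe (.app v w)
  | unbox (n : ℕ) {v : Exp} : IsNe v → IsNe (.unbox n v)
end

/-! ### Kripke-style weakenings -/

/-- `IsKWk L γ Γ Δ`: the K-substitution `γ` is a K-weakening `Γ ⇒ Δ`, that is, it is generated by
the empty K-weakening, `q`, `p`, and the extension by an unbox level of the system. Two
K-weakenings are the same if they are the same as K-substitutions. -/
inductive IsKWk (L : Logic) : KSub → Stack → Stack → Prop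
  | nil : IsKWk L (.base []) ⟨[], []⟩ ⟨[], []⟩
  | q {γ : KSub} {Γ Δ : Stack} (T : Ty) :
      IsKWk L γ Γ Δ → IsKWk L γ.lift (Γ.bind T) (Δ.bind T)
  | p {γ : KSub} {Γ Δ : Stack} (T : Ty) :
      IsKWk L γ Γ Δ → IsKWk L γ.weaken (Γ.bind T) Δ
  | ext {γ : KSub} {n : ℕ} {Γ Δ : Stack} :
      n ∈ L.UL → n < Γ.size → IsKWk L γ (Γ.trunc n) Δ → IsKWk L (γ.ext n []) Γ (Δ.push [])

/-! ### Properties of truncation -/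

theorem Stack.trunc_add (Γ : Stack) (n m : ℕ) : Γ.trunc (n + m) = (Γ.trunc n).trunc m := by
  obtain ⟨b, t⟩ := Γ
  induction n generalizing b t with
  | zero => simp [trunc]
  | succ n ih =>
    rw [Nat.add_right_comm]
    cases b with
    | nil => cases m <;> simp [trunc]
    | cons G b => simpa [trunc] using ih b G

theorem Stack.size_trunc {Γ : Stack} {n : ℕ} (h : n < Γ.size) :
    (Γ.trunc n).size = Γ.size - n := by
  obtain ⟨b, t⟩ := Γ
  induction n generalizing b t with
  | zero => simp [trunc]
  | succ n ih =>
    cases b with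
    | nil => simp [size] at h
    | cons G b =>
      have := ih b G (by simp [size] at h ⊢; omega)
      simp [trunc, size] at this ⊢; omega

theorem Stack.size_pos (Γ : Stack) : 0 < Γ.size := Nat.succ_pos _

theorem Stack.trunc_bind (Γ : Stack) (T : Ty) (n : ℕ) :
    (Γ.bind T).trunc (n + 1) = Γ.trunc (n + 1) := by
  obtain ⟨_ | ⟨G, b⟩, t⟩ := Γ <;> rfl

theorem Stack.trunc_push (Γ : Stack) (D : Ctx) (n : ℕ) :
    (Γ.push D).trunc (n + 1) = Γ.trunc n := rfl

theorem Stack.size_push (Γ : Stack) (D : Ctx) : (Γ.push D).size = Γ.size + 1 := rfl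

theorem Stack.one_lt_size_push (Γ : Stack) (D : Ctx) : 1 < (Γ.push D).size :=
  Nat.succ_lt_succ Γ.size_pos

theorem Stack.size_bind (Γ : Stack) (T : Ty) : (Γ.bind T).size = Γ.size := rfl

theorem Logic.one_mem (L : Logic) : 1 ∈ L.UL := by cases L <;> simp [Logic.UL]

namespace KSub

theorem offset_zero (s : KSub) : s.offset 0 = 0 := by cases s <;> rfl

theorem trunc_zero (s : KSub) : s.trunc 0 = s := by cases s <;> rfl

theorem offset_add (s : KSub) (n m : ℕ) :
    s.offset (n + m) = s.offset n + (s.trunc n).offset m := by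
  induction n generalizing s with
  | zero => simp [offset_zero, trunc_zero]
  | succ n ih =>
    rw [Nat.add_right_comm]
    cases s with
    | base σ => cases m <;> simp [offset, trunc]
    | ext s k σ => simp [offset, trunc, ih, Nat.add_assoc]

theorem trunc_add (s : KSub) (n m : ℕ) : s.trunc (n + m) = (s.trunc n).trunc m := by
  induction n generalizing s with
  | zero => simp [trunc_zero]
  | succ n ih =>
    rw [Nat.add_right_comm]
    cases s with
    | base σ => cases m <;> simp [trunc]
    | ext s k σ => simp [trunc, ih]

theorem offset_weaken (s : KSub) (n : ℕ) : s.weaken.offset n = s.offset n := by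
  induction n generalizing s with
  | zero => simp [offset_zero]
  | succ n ih =>
    cases s with
    | base σ => rfl
    | ext s k σ => simp only [weaken, offset]; split_ifs <;> simp [ih]

theorem trunc_weaken (s : KSub) (n : ℕ) :
    s.weaken.trunc n = if s.offset n = 0 then (s.trunc n).weaken else s.trunc n := by
  induction n generalizing s with
  | zero => simp [offset_zero, trunc_zero]
  | succ n ih =>
    cases s with
    | base σ => simp [weaken, trunc, offset]
    | ext s k σ =>
      by_cases hk : k = 0 <;> simp [weaken, offset, trunc, hk, ih]

theorem offset_snoc (s : KSub) (t : Exp) (n : ℕ) : (s.snoc t).offset n = s.offset n := by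
  cases n <;> cases s <;> rfl

theorem trunc_snoc (s : KSub) (t : Exp) (n : ℕ) :
    (s.snoc t).trunc (n + 1) = s.trunc (n + 1) := by
  cases s <;> rfl

theorem offset_lift (s : KSub) (n : ℕ) : s.lift.offset n = s.offset n := by
  rw [lift, offset_snoc, offset_weaken]

theorem trunc_lift (s : KSub) (n : ℕ) :
    s.lift.trunc (n + 1) =
      if s.offset (n + 1) = 0 then (s.trunc (n + 1)).weaken else s.trunc (n + 1) := by
  rw [lift, trunc_snoc, trunc_weaken]

theorem top_weaken (s : KSub) : s.weaken.top = s.top.map Exp.wk := by cases s <;> rfl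

theorem top_snoc (s : KSub) (t : Exp) : (s.snoc t).top = t :: s.top := by cases s <;> rfl

theorem top_comp (s d : KSub) : (s.comp d).top = s.top.map fun t => t.sub d := by
  cases s <;> rfl

theorem offset_comp (s d : KSub) (n : ℕ) : (s.comp d).offset n = d.offset (s.offset n) := by
  induction n generalizing s d with
  | zero => simp [offset_zero]
  | succ n ih =>
    cases s with
    | base σ => simp [comp, offset, offset_zero]
    | ext s k σ => simp only [comp, offset]; rw [ih, offset_add]

theorem trunc_comp (s d : KSub) (n : ℕ) :
    (s.comp d).trunc n = (s.trunc n).comp (d.trunc (s.offset n)) := by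
  induction n generalizing s d with
  | zero => simp [offset_zero, trunc_zero]
  | succ n ih =>
    cases s with
    | base σ => simp [comp, trunc]
    | ext s k σ => simp only [comp, trunc, offset]; rw [ih, trunc_add]

theorem snoc_comp (s d : KSub) (t : Exp) : (s.snoc t).comp d = (s.comp d).snoc (t.sub d) := by
  cases s <;> rfl

theorem offset_id (Γ : Stack) (n : ℕ) (h : n < Γ.size) : (id Γ).offset n = n := by
  obtain ⟨b, t⟩ := Γ
  induction n generalizing b t with
  | zero => exact offset_zero _
  | succ n ih =>
    cases b with
    | nil => simp [Stack.size] at h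
    | cons G b =>
      have := ih b G (by simp [Stack.size] at h ⊢; omega)
      simp only [id, idAux, offset] at this ⊢; omega

theorem trunc_id (Γ : Stack) (n : ℕ) (h : n < Γ.size) : (id Γ).trunc n = id (Γ.trunc n) := by
  obtain ⟨b, t⟩ := Γ
  induction n generalizing b t with
  | zero => exact trunc_zero _
  | succ n ih =>
    cases b with
    | nil => simp [Stack.size] at h
    | cons G b => exact ih b G (by simp [Stack.size] at h ⊢; omega)

theorem top_id (Γ : Stack) : (id Γ).top = localId Γ.top := by
  obtain ⟨_ | ⟨G, b⟩, t⟩ := Γ <;> rfl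

theorem localId_cons (T : Ty) (Γ : Ctx) : localId (T :: Γ) = .var 0 :: (localId Γ).map Exp.wk := by
  simp [localId, List.range_succ_eq_map, Function.comp_def, Exp.wk, Exp.shift]

theorem id_bind (Γ : Stack) (T : Ty) : id (Γ.bind T) = (id Γ).lift := by
  obtain ⟨_ | ⟨G, b⟩, t⟩ := Γ <;>
    simp [Stack.bind, id, idAux, lift, weaken, snoc, localId_cons]

end KSub

namespace IsKWk

variable {L : Logic} {γ δ θ : KSub} {Γ Δ Θ Ψ : Stack}

theorem top_length (h : IsKWk L γ Γ Δ) : γ.top.length = Δ.top.length := by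
  induction h with
  | nil => rfl
  | q T h ih => simp [KSub.lift, KSub.top_snoc, KSub.top_weaken, ih, Stack.bind]
  | p T h ih => simp [KSub.top_weaken, ih]
  | ext => rfl

/-- The topmost local substitution of a K-weakening consists of variables of the right types. -/
theorem nonempty_hasVar (h : IsKWk L γ Γ Δ) {x : ℕ} {T : Ty} (v : HasVar Δ.top x T) :
    ∃ y, γ.top[x]? = some (.var y) ∧ Nonempty (HasVar Γ.top y T) := by
  induction h generalizing x with
  | nil => cases v
  | q S h ih =>
    cases v with
    | here => exact ⟨0, by simp [KSub.lift, KSub.top_snoc], ⟨.here⟩⟩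
    | there v =>
      obtain ⟨y, hy, ⟨w⟩⟩ := ih v
      exact ⟨y + 1, by simp [KSub.lift, KSub.top_snoc, KSub.top_weaken, hy, Exp.wk, Exp.shift],
        ⟨.there w⟩⟩
  | p S h ih =>
    obtain ⟨y, hy, ⟨w⟩⟩ := ih v
    exact ⟨y + 1, by simp [KSub.top_weaken, hy, Exp.wk, Exp.shift], ⟨.there w⟩⟩
  | ext => cases v

theorem trunc_aux (h : IsKWk L γ Γ Δ) {n : ℕ} (hn : n < Δ.size) :
    γ.offset n < Γ.size ∧ IsKWk L (γ.trunc n) (Γ.trunc (γ.offset n)) (Δ.trunc n) := by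
  induction h generalizing n with
  | nil =>
    obtain rfl : n = 0 := by simpa [Stack.size] using hn
    exact ⟨by simp [KSub.offset_zero, Stack.size], .nil⟩
  | @q γ Γ Δ T h ih =>
    cases n with
    | zero =>
      rw [KSub.offset_zero, KSub.trunc_zero]
      exact ⟨Stack.size_pos _, .q T h⟩
    | succ n =>
      rw [KSub.offset_lift, KSub.trunc_lift, Stack.trunc_bind]
      obtain ⟨h1, h2⟩ := ih hn
      refine ⟨h1, ?_⟩
      split_ifs with h0
      · rw [h0] at h2 ⊢
        exact .p T h2
      · obtain ⟨k, hk⟩ := Nat.exists_eq_succ_of_ne_zero h0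
        rw [hk] at h2 ⊢
        rwa [Nat.succ_eq_add_one, Stack.trunc_bind]
  | @p γ Γ Δ T h ih =>
    rw [KSub.offset_weaken, KSub.trunc_weaken]
    obtain ⟨h1, h2⟩ := ih hn
    refine ⟨h1, ?_⟩
    split_ifs with h0
    · rw [h0] at h2 ⊢
      exact .p T h2
    · obtain ⟨k, hk⟩ := Nat.exists_eq_succ_of_ne_zero h0
      rw [hk] at h2 ⊢
      rwa [Nat.succ_eq_add_one, Stack.trunc_bind]
  | @ext γ m Γ Δ hm hlt h ih =>
    cases n with
    | zero =>
      rw [KSub.offset_zero, KSub.trunc_zero]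
      exact ⟨Stack.size_pos _, .ext hm hlt h⟩
    | succ n =>
      obtain ⟨h1, h2⟩ := ih (n := n) (by simpa [Stack.size_push] using hn)
      rw [Stack.size_trunc hlt] at h1
      simp only [KSub.offset, KSub.trunc, Stack.trunc_push]
      rw [Stack.trunc_add]
      exact ⟨by omega, h2⟩

theorem offset_lt (h : IsKWk L γ Γ Δ) {n : ℕ} (hn : n < Δ.size) : γ.offset n < Γ.size :=
  (h.trunc_aux hn).1

/-- A truncated K-weakening is a K-weakening. -/
theorem trunc (h : IsKWk L γ Γ Δ) {n : ℕ} (hn : n < Δ.size) :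
    IsKWk L (γ.trunc n) (Γ.trunc (γ.offset n)) (Δ.trunc n) :=
  (h.trunc_aux hn).2

theorem offset_one_mem (h : IsKWk L γ Γ Δ) (hn : 1 < Δ.size) : γ.offset 1 ∈ L.UL := by
  induction h with
  | nil => simp [Stack.size] at hn
  | q T h ih => rw [KSub.offset_lift]; exact ih hn
  | p T h ih => rw [KSub.offset_weaken]; exact ih hn
  | ext hm _ _ _ => simpa [KSub.offset, KSub.offset_zero] using hm

/-- The truncation offset at an unbox level is an unbox level of the same system. -/
theorem offset_mem (h : IsKWk L γ Γ Δ) {n : ℕ} (hn : n < Δ.size) (hL : n ∈ L.UL) :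
    γ.offset n ∈ L.UL := by
  cases L with
  | K => obtain rfl : n = 1 := hL; exact h.offset_one_mem hn
  | T =>
    obtain rfl | rfl : n = 0 ∨ n = 1 := hL
    · rw [KSub.offset_zero]; exact Or.inl rfl
    · exact h.offset_one_mem hn
  | K4 =>
    obtain ⟨k, rfl⟩ : ∃ k, n = 1 + k := Nat.exists_eq_add_of_le hL
    have h1 : 1 ≤ γ.offset 1 := h.offset_one_mem (by omega)
    rw [KSub.offset_add]
    exact Nat.le_add_right_of_le h1
  | S4 => trivial

end IsKWk

/-! ### The category of K-weakenings -/

/-- `s` is a raw K-substitution with domain `Γ` all of whose terms are variables. -/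
def KSub.IsRen : KSub → Stack → Prop
  | .base σ, Γ => ∀ t ∈ σ, ∃ y, t = .var y ∧ y < Γ.top.length
  | .ext s n σ, Γ =>
    (∀ t ∈ σ, ∃ y, t = .var y ∧ y < Γ.top.length) ∧ n < Γ.size ∧ s.IsRen (Γ.trunc n)

theorem KSub.IsRen.of_top {s : KSub} {Γ : Stack} (h : s.IsRen Γ) :
    ∀ t ∈ s.top, ∃ y, t = .var y ∧ y < Γ.top.length := by
  cases s with
  | base σ => exact h
  | ext s n σ => exact h.1

theorem KSub.IsRen.weaken {s : KSub} {Γ : Stack} (h : s.IsRen Γ) (T : Ty) :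
    s.weaken.IsRen (Γ.bind T) := by
  have key : ∀ (Γ : Stack) (σ : List Exp), (∀ t ∈ σ, ∃ y, t = .var y ∧ y < Γ.top.length) →
      ∀ t ∈ σ.map Exp.wk, ∃ y, t = .var y ∧ y < (Γ.bind T).top.length := by
    intro Γ σ h t ht
    obtain ⟨u, hu, rfl⟩ := List.mem_map.1 ht
    obtain ⟨y, rfl, hy⟩ := h u hu
    exact ⟨y + 1, by simp [Exp.wk, Exp.shift], by simpa [Stack.bind] using hy⟩
  induction s generalizing Γ with
  | base σ => exact key Γ σ h
  | ext s n σ ih =>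
    refine ⟨key Γ σ h.1, h.2.1, ?_⟩
    split_ifs with h0
    · subst h0
      exact ih h.2.2
    · obtain ⟨k, rfl⟩ := Nat.exists_eq_succ_of_ne_zero h0
      rw [Nat.succ_eq_add_one, Stack.trunc_bind]
      exact h.2.2

theorem KSub.IsRen.lift {s : KSub} {Γ : Stack} (h : s.IsRen Γ) (T : Ty) :
    s.lift.IsRen (Γ.bind T) := by
  have h' := h.weaken T
  rw [KSub.lift]
  have h0 : ∃ y, Exp.var 0 = .var y ∧ y < (Γ.bind T).top.length :=
    ⟨0, rfl, by simp [Stack.bind]⟩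
  generalize s.weaken = r at h'
  cases r with
  | base σ => exact List.forall_mem_cons.2 ⟨h0, h'⟩
  | ext r n σ => exact ⟨List.forall_mem_cons.2 ⟨h0, h'.1⟩, h'.2⟩

namespace IsKWk

variable {L : Logic} {γ δ θ : KSub} {Γ Δ Θ Ψ : Stack}

theorem isRen (h : IsKWk L γ Γ Δ) : γ.IsRen Γ := by
  induction h with
  | nil => simp [KSub.IsRen]
  | q T h ih => exact ih.lift T
  | p T h ih => exact ih.weaken T
  | ext hm hlt h ih => exact ⟨by simp, hlt, ih⟩

end IsKWk

theorem Exp.sub_var_of_lt {s : KSub} {x : ℕ} (h : x < s.top.length) :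
    (Exp.var x).sub s = s.top[x] := by
  simp [Exp.sub, h]

theorem Exp.sub_weaken_var {s : KSub} {x : ℕ} (h : x < s.top.length) :
    (Exp.var x).sub s.weaken = ((Exp.var x).sub s).wk := by
  rw [Exp.sub_var_of_lt h, Exp.sub_var_of_lt (by simpa [KSub.top_weaken] using h)]
  simp [KSub.top_weaken]

theorem Exp.wk_sub_lift_var {s : KSub} {x : ℕ} (h : x < s.top.length) :
    (Exp.var x).wk.sub s.lift = ((Exp.var x).sub s).wk := by
  rw [Exp.sub_var_of_lt h]
  simp [Exp.wk, Exp.shift, Exp.sub, KSub.lift, KSub.top_snoc, KSub.top_weaken, h]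

namespace KSub

variable {L : Logic} {γ δ θ : KSub} {Γ Δ Θ Ψ : Stack}

theorem comp_weaken (h : γ.IsRen Γ) (hδ : IsKWk L δ Ψ Γ) :
    γ.comp δ.weaken = (γ.comp δ).weaken := by
  have key : ∀ (Γ Ψ : Stack) (δ : KSub) (σ : List Exp), IsKWk L δ Ψ Γ →
      (∀ t ∈ σ, ∃ y, t = .var y ∧ y < Γ.top.length) →
      (σ.map fun t => t.sub δ.weaken) = (σ.map fun t => t.sub δ).map Exp.wk := by
    intro Γ Ψ δ σ hδ hσ
    rw [List.map_map]
    refine List.map_congr_left fun t ht => ?_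
    obtain ⟨y, rfl, hy⟩ := hσ t ht
    exact Exp.sub_weaken_var (by rwa [hδ.top_length])
  induction γ generalizing Γ Ψ δ with
  | base σ => simp only [comp, weaken, key Γ Ψ δ σ hδ h]
  | ext s n σ ih =>
    simp only [comp, weaken, offset_weaken, trunc_weaken, key Γ Ψ δ σ hδ h.1]
    split_ifs with h0
    · rw [ih h.2.2 (hδ.trunc h.2.1)]
    · rfl

theorem weaken_comp_lift (h : γ.IsRen Γ) (hδ : IsKWk L δ Ψ Γ) :
    γ.weaken.comp δ.lift = (γ.comp δ).weaken := by
  have key : ∀ (Γ Ψ : Stack) (δ : KSub) (σ : List Exp), IsKWk L δ Ψ Γ →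
      (∀ t ∈ σ, ∃ y, t = .var y ∧ y < Γ.top.length) →
      ((σ.map Exp.wk).map fun t => t.sub δ.lift) = (σ.map fun t => t.sub δ).map Exp.wk := by
    intro Γ Ψ δ σ hδ hσ
    rw [List.map_map, List.map_map]
    refine List.map_congr_left fun t ht => ?_
    obtain ⟨y, rfl, hy⟩ := hσ t ht
    exact Exp.wk_sub_lift_var (by rwa [hδ.top_length])
  induction γ generalizing Γ Ψ δ with
  | base σ => simp only [comp, weaken, key Γ Ψ δ σ hδ h]
  | ext s n σ ih =>
    simp only [comp, weaken, offset_lift, key Γ Ψ δ σ hδ h.1]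
    congr 1
    by_cases hn : n = 0
    · subst hn
      simp only [if_true, trunc_zero, offset_zero]
      exact ih h.2.2 hδ
    · obtain ⟨k, rfl⟩ := Nat.exists_eq_succ_of_ne_zero hn
      rw [if_neg hn, Nat.succ_eq_add_one, trunc_lift]
      split_ifs with h0
      · exact comp_weaken h.2.2 (hδ.trunc h.2.1)
      · rfl

theorem lift_comp_lift (h : γ.IsRen Γ) (hδ : IsKWk L δ Ψ Γ) :
    γ.lift.comp δ.lift = (γ.comp δ).lift := by
  rw [lift, snoc_comp, weaken_comp_lift h hδ, lift]
  simp [Exp.sub, lift, top_snoc]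

theorem comp_assoc (h : γ.IsRen Γ) (hδ : IsKWk L δ Ψ Γ) (θ : KSub) :
    (γ.comp δ).comp θ = γ.comp (δ.comp θ) := by
  have key : ∀ (Γ Ψ : Stack) (δ θ : KSub) (σ : List Exp), IsKWk L δ Ψ Γ →
      (∀ t ∈ σ, ∃ y, t = .var y ∧ y < Γ.top.length) →
      ((σ.map fun t => t.sub δ).map fun t => t.sub θ) = σ.map fun t => t.sub (δ.comp θ) := by
    intro Γ Ψ δ θ σ hδ hσ
    rw [List.map_map]
    refine List.map_congr_left fun t ht => ?_
    obtain ⟨y, rfl, hy⟩ := hσ t ht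
    rw [← hδ.top_length] at hy
    rw [Function.comp_apply, Exp.sub_var_of_lt hy,
      Exp.sub_var_of_lt (by simpa [top_comp] using hy)]
    simp [top_comp]
  induction γ generalizing Γ Ψ δ θ with
  | base σ => simp only [comp, key Γ Ψ δ θ σ hδ h]
  | ext s n σ ih =>
    simp only [comp, key Γ Ψ δ θ σ hδ h.1, offset_comp, trunc_comp]
    rw [ih h.2.2 (hδ.trunc h.2.1)]

theorem comp_id (h : γ.IsRen Γ) : γ.comp (id Γ) = γ := by
  have key : ∀ (Γ : Stack) (σ : List Exp),
      (∀ t ∈ σ, ∃ y, t = .var y ∧ y < Γ.top.length) → (σ.map fun t => t.sub (id Γ)) = σ := by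
    intro Γ σ hσ
    refine (List.map_congr_left fun t ht => ?_).trans (List.map_id σ)
    obtain ⟨y, rfl, hy⟩ := hσ t ht
    simp [Exp.sub, top_id, localId, hy]
  induction γ generalizing Γ with
  | base σ => simp only [comp, key Γ σ h]
  | ext s n σ ih =>
    simp only [comp, key Γ σ h.1, offset_id Γ n h.2.1, trunc_id Γ n h.2.1, ih h.2.2]

end KSub

namespace IsKWk

variable {L : Logic} {γ δ θ : KSub} {Γ Δ Θ Ψ : Stack}

theorem exists_base (h : IsKWk L γ Γ Δ) (hΔ : Δ.below = []) : ∃ σ, γ = .base σ := by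
  induction h with
  | nil => exact ⟨[], rfl⟩
  | q T h ih => obtain ⟨σ, rfl⟩ := ih hΔ; exact ⟨_, rfl⟩
  | p T h ih => obtain ⟨σ, rfl⟩ := ih hΔ; exact ⟨_, rfl⟩
  | ext => cases hΔ

theorem exists_ext (h : IsKWk L γ Γ Δ) (hΔ : Δ.below ≠ []) : ∃ s n σ, γ = .ext s n σ := by
  induction h with
  | nil => exact absurd rfl hΔ
  | q T h ih => obtain ⟨s, n, σ, rfl⟩ := ih hΔ; exact ⟨_, _, _, rfl⟩
  | p T h ih => obtain ⟨s, n, σ, rfl⟩ := ih hΔ; exact ⟨_, _, _, rfl⟩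
  | ext => exact ⟨_, _, _, rfl⟩

end IsKWk

theorem KSub.localId_map_sub {Γ : Ctx} {γ : KSub} (h : γ.top.length = Γ.length) :
    ((localId Γ).map fun t => t.sub γ) = γ.top := by
  refine List.ext_getElem (by simp [localId, h]) fun i h1 h2 => ?_
  simp [localId, Exp.sub, h2]

theorem IsKWk.id_comp {L : Logic} {γ : KSub} {Γ Δ : Stack} (h : IsKWk L γ Γ Δ) :
    (KSub.id Δ).comp γ = γ := by
  obtain ⟨b, t⟩ := Δ
  induction b generalizing γ Γ t with
  | nil =>
    obtain ⟨σ, rfl⟩ := h.exists_base rfl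
    simp only [KSub.id, KSub.idAux, KSub.comp, KSub.localId_map_sub h.top_length]
    rfl
  | cons G b ih =>
    obtain ⟨s, n, σ, rfl⟩ := h.exists_ext (by simp)
    have h1 := ih G (h.trunc (n := 1) (by simp [Stack.size]))
    simp only [KSub.id, KSub.idAux, KSub.comp, KSub.localId_map_sub h.top_length] at h1 ⊢
    rw [h1]
    simp [KSub.trunc, KSub.offset, KSub.trunc_zero, KSub.offset_zero, KSub.top]

namespace IsKWk

variable {L : Logic} {γ δ θ : KSub} {Γ Δ Θ Ψ : Stack}

theorem id (L : Logic) (Γ : Stack) : IsKWk L (KSub.id Γ) Γ Γ := by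
  obtain ⟨b, t⟩ := Γ
  induction b generalizing t with
  | nil =>
    induction t with
    | nil => exact .nil
    | cons T t ih =>
      have := ih.q T
      rwa [← KSub.id_bind] at this
  | cons G b ih =>
    induction t with
    | nil => exact .ext (Γ := ⟨G :: b, []⟩) L.one_mem (by simp [Stack.size]) (ih G)
    | cons T t ih =>
      have := ih.q T
      rwa [← KSub.id_bind] at this

theorem comp_nil_aux (h : IsKWk L δ Ψ Γ) (hb : Γ.below = []) (ht : Γ.top = []) :
    δ = .base [] := by
  obtain ⟨σ, rfl⟩ := h.exists_base hb
  have := h.top_length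
  rw [ht] at this
  simp only [KSub.top, List.length_nil, List.length_eq_zero_iff] at this
  rw [this]

/-- K-weakenings are closed under composition. -/
theorem comp (h : IsKWk L γ Γ Δ) (hδ : IsKWk L δ Ψ Γ) : IsKWk L (γ.comp δ) Ψ Δ := by
  induction h generalizing Ψ δ with
  | nil =>
    obtain rfl := hδ.comp_nil_aux rfl rfl
    exact hδ
  | @q γ Γ Δ T h ih =>
    generalize hΓ : Γ.bind T = Γ' at hδ
    induction hδ with
    | nil => exact absurd (congrArg Stack.top hΓ) (by simp [Stack.bind])
    | @q δ Ψ Γ₁ S hδ _ =>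
      obtain ⟨rfl, rfl⟩ : S = T ∧ Γ₁ = Γ := by
        cases Γ; cases Γ₁; simp only [Stack.bind, Stack.mk.injEq, List.cons.injEq] at hΓ
        obtain ⟨rfl, rfl, rfl⟩ := hΓ; exact ⟨rfl, rfl⟩
      rw [KSub.lift_comp_lift h.isRen hδ]
      exact (ih hδ).q S
    | @p δ Ψ Γ₁ S hδ ihδ =>
      subst hΓ
      rw [KSub.comp_weaken (h.q T).isRen hδ]
      exact (ihδ rfl).p S
    | ext => exact absurd (congrArg Stack.top hΓ) (by simp [Stack.bind, Stack.push])
  | @p γ Γ Δ T h ih =>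
    generalize hΓ : Γ.bind T = Γ' at hδ
    induction hδ with
    | nil => exact absurd (congrArg Stack.top hΓ) (by simp [Stack.bind])
    | @q δ Ψ Γ₁ S hδ _ =>
      obtain ⟨rfl, rfl⟩ : S = T ∧ Γ₁ = Γ := by
        cases Γ; cases Γ₁; simp only [Stack.bind, Stack.mk.injEq, List.cons.injEq] at hΓ
        obtain ⟨rfl, rfl, rfl⟩ := hΓ; exact ⟨rfl, rfl⟩
      rw [KSub.weaken_comp_lift h.isRen hδ]
      exact (ih hδ).p S
    | @p δ Ψ Γ₁ S hδ ihδ =>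
      subst hΓ
      rw [KSub.comp_weaken (h.p T).isRen hδ]
      exact (ihδ rfl).p S
    | ext => exact absurd (congrArg Stack.top hΓ) (by simp [Stack.bind, Stack.push])
  | @ext γ n Γ Δ hm hlt h ih =>
    exact .ext (hδ.offset_mem hlt hm) (hδ.offset_lt hlt) (ih (hδ.trunc hlt))

end IsKWk

/-- The objects of the category of K-weakenings: context stacks. -/
def WkCat (_ : Logic) : Type := Stack

/-- The category of K-weakenings: a morphism `Γ ⟶ Δ` is a K-weakening `Γ ⇒ Δ`. -/
instance (L : Logic) : Category (WkCat L) where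
  Hom Γ Δ := {γ : KSub // IsKWk L γ Γ Δ}
  id Γ := ⟨KSub.id Γ, IsKWk.id L Γ⟩
  comp f g := ⟨g.1.comp f.1, g.2.comp f.2⟩
  id_comp f := Subtype.ext (KSub.comp_id f.2.isRen)
  comp_id f := Subtype.ext f.2.id_comp
  assoc f g h := Subtype.ext (KSub.comp_assoc h.2.isRen g.2 f.1).symm

/-! ### The action of K-weakenings on terms -/

theorem HasVar.lt_length {Γ : Ctx} {x : ℕ} {T : Ty} (v : HasVar Γ x T) : x < Γ.length := by
  induction v with
  | here => simp
  | there v ih => simpa using ih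

theorem Typing.nonempty_sub {L : Logic} {γ : KSub} {Γ Δ : Stack} {t : Exp} {T : Ty}
    (d : Typing L Δ t T) (h : IsKWk L γ Γ Δ) : Nonempty (Typing L Γ (t.sub γ) T) := by
  induction d generalizing γ Γ with
  | var v =>
    obtain ⟨y, hy, ⟨w⟩⟩ := h.nonempty_hasVar v
    refine ⟨?_⟩
    rw [Exp.sub, List.getD_eq_getElem?_getD, hy]
    exact .var w
  | box d ih =>
    obtain ⟨d'⟩ := ih (.ext (Γ := Γ.push []) L.one_mem (Stack.one_lt_size_push _ _) h)
    exact ⟨.box d'⟩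
  | unbox hL hn d ih =>
    obtain ⟨d'⟩ := ih (h.trunc hn)
    exact ⟨.unbox (h.offset_mem hn hL) (h.offset_lt hn) d'⟩
  | lam d ih =>
    obtain ⟨d'⟩ := ih (h.q _)
    exact ⟨.lam d'⟩
  | app d e ihd ihe =>
    obtain ⟨d'⟩ := ihd h
    obtain ⟨e'⟩ := ihe h
    exact ⟨.app d' e'⟩

theorem Typing.sub_id {L : Logic} {Γ : Stack} {t : Exp} {T : Ty} (d : Typing L Γ t T) :
    t.sub (KSub.id Γ) = t := by
  induction d with
  | var v => simp [Exp.sub, KSub.top_id, KSub.localId, v.lt_length]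
  | box d ih => rw [Exp.sub]; exact congrArg Exp.box ih
  | unbox hL hn d ih => rw [Exp.sub, KSub.offset_id _ _ hn, KSub.trunc_id _ _ hn, ih]
  | lam d ih => rw [Exp.sub, ← KSub.id_bind, ih]
  | app d e ihd ihe => rw [Exp.sub, ihd, ihe]

theorem Typing.sub_comp {L : Logic} {γ δ : KSub} {Γ Δ Ψ : Stack} {t : Exp} {T : Ty}
    (d : Typing L Δ t T) (h : IsKWk L γ Γ Δ) (hδ : IsKWk L δ Ψ Γ) :
    t.sub (γ.comp δ) = (t.sub γ).sub δ := by
  induction d generalizing γ δ Γ Ψ with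
  | var v =>
    have hx := v.lt_length
    rw [← h.top_length] at hx
    rw [Exp.sub_var_of_lt hx, Exp.sub_var_of_lt (by simpa [KSub.top_comp] using hx)]
    simp [KSub.top_comp]
  | box d ih =>
    have := ih (.ext (Γ := Γ.push []) L.one_mem (Stack.one_lt_size_push _ _) h)
      (.ext (Γ := Ψ.push []) L.one_mem (Stack.one_lt_size_push _ _) hδ)
    simp only [KSub.comp, KSub.trunc, KSub.offset, KSub.trunc_zero, KSub.offset_zero] at this
    simpa [Exp.sub] using this
  | unbox hL hn d ih =>
    simp only [Exp.sub]
    rw [KSub.offset_comp, KSub.trunc_comp, ih (h.trunc hn) (hδ.trunc (h.offset_lt hn))]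
  | lam d ih =>
    simp only [Exp.sub]
    rw [← KSub.lift_comp_lift h.isRen hδ, ih (h.q _) (hδ.q _)]
  | app d e ihd ihe => simp only [Exp.sub]; rw [ihd h hδ, ihe h hδ]

mutual
theorem IsNf.sub {L : Logic} {t : Exp} : IsNf t → ∀ {γ : KSub} {Γ Δ : Stack} {T : Ty},
    Typing L Δ t T → IsKWk L γ Γ Δ → IsNf (t.sub γ)
  | .ne v, _, _, _, _, d, h => .ne (IsNe.sub v d h)
  | .box w, _, Γ, _, _, .box d, h =>
    .box (IsNf.sub w d
      (.ext (Γ := Γ.push []) L.one_mem (Stack.one_lt_size_push _ _) h))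
  | .lam w, _, _, _, _, .lam d, h => .lam (IsNf.sub w d (h.q _))
theorem IsNe.sub {L : Logic} {t : Exp} : IsNe t → ∀ {γ : KSub} {Γ Δ : Stack} {T : Ty},
    Typing L Δ t T → IsKWk L γ Γ Δ → IsNe (t.sub γ)
  | .var _, γ, _, _, _, .var v, h => by
    obtain ⟨y, hy, _⟩ := h.nonempty_hasVar v
    rw [Exp.sub, List.getD_eq_getElem?_getD, hy]
    exact .var y
  | .app v w, _, _, _, _, .app d e, h => .app (IsNe.sub v d h) (IsNf.sub w e h)
  | .unbox _ v, _, _, _, _, .unbox _ hn d, h => .unbox _ (IsNe.sub v d (h.trunc hn))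
end

/-! ### Presheaves -/

/-- Presheaves over the category of K-weakenings. -/
abbrev PSh (L : Logic) := (WkCat L)ᵒᵖ ⥤ Type

variable {L : Logic}

/-- The presheaf of neutral terms of type `T`. -/
def Ne (L : Logic) (T : Ty) : PSh L where
  obj Γ := {v : Exp // IsNe v ∧ Nonempty (Typing L Γ.unop v T)}
  map γ := ↾fun v => ⟨v.1.sub γ.unop.1,
    v.2.1.sub v.2.2.some γ.unop.2, v.2.2.some.nonempty_sub γ.unop.2⟩
  map_id Γ := by
    ext v
    exact v.2.2.some.sub_id
  map_comp γ δ := by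
    ext v
    exact v.2.2.some.sub_comp γ.unop.2 δ.unop.2

/-- The presheaf of normal forms of type `T`. -/
def Nf (L : Logic) (T : Ty) : PSh L where
  obj Γ := {w : Exp // IsNf w ∧ Nonempty (Typing L Γ.unop w T)}
  map γ := ↾fun w => ⟨w.1.sub γ.unop.1,
    w.2.1.sub w.2.2.some γ.unop.2, w.2.2.some.nonempty_sub γ.unop.2⟩
  map_id Γ := by
    ext w
    exact w.2.2.some.sub_id
  map_comp γ δ := by
    ext w
    exact w.2.2.some.sub_comp γ.unop.2 δ.unop.2

namespace WkCat

/-- `Γ⃗ ; Δ`. -/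
abbrev push (Γ : WkCat L) (Δ : Ctx) : WkCat L := Stack.push Γ Δ

/-- `Γ⃗ ; (Γ, x : T)`. -/
abbrev bind (Γ : WkCat L) (T : Ty) : WkCat L := Stack.bind Γ T

/-- `Γ⃗ | n`. -/
abbrev trunc (Γ : WkCat L) (n : ℕ) : WkCat L := Stack.trunc Γ n

/-- `|Γ⃗|`. -/
abbrev size (Γ : WkCat L) : ℕ := Stack.size Γ

/-- The K-weakening `p(id⃗) : Γ⃗;(Γ, x : S) ⇒ Γ⃗;Γ`. -/
def pId (Γ : WkCat L) (S : Ty) : Γ.bind S ⟶ Γ :=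
  ⟨(KSub.id Γ).weaken, (IsKWk.id L Γ).p S⟩

/-- The K-weakening `q(γ⃗)`. -/
def q {Γ Δ : WkCat L} (γ : Γ ⟶ Δ) (S : Ty) :
    Γ.bind S ⟶ Δ.bind S :=
  ⟨γ.1.lift, γ.2.q S⟩

/-- The K-weakening `id⃗ ; ⇑ⁿ : Δ⃗ ⇒ (Δ⃗ | n) ; ·`. -/
def idExt (Δ : WkCat L) (n : ℕ) (hL : n ∈ L.UL) (hn : n < Δ.size) :
    Δ ⟶ (Δ.trunc n).push [] :=
  ⟨(KSub.id (Δ.trunc n)).ext n [], .ext hL hn (IsKWk.id L _)⟩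

/-- The truncated K-weakening `γ⃗ | n`. -/
def truncHom {Γ Δ : WkCat L} (γ : Γ ⟶ Δ) (n : ℕ) (hn : n < Δ.size) :
    Γ.trunc (γ.1.offset n) ⟶ Δ.trunc n :=
  ⟨γ.1.trunc n, γ.2.trunc hn⟩

/-- The functor to the next world, `Γ⃗ ↦ Γ⃗ ; ·` and `γ⃗ ↦ γ⃗ ; ⇑¹`. -/
def next (L : Logic) : WkCat L ⥤ WkCat L where
  obj Γ := Γ.push []
  map {Γ Δ} γ := ⟨γ.1.ext 1 [],
    .ext (Γ := Stack.push Γ []) L.one_mem (Stack.one_lt_size_push _ _) γ.2⟩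
  map_id Γ := rfl
  map_comp γ δ := Subtype.ext (by
    show KSub.ext _ _ _ = KSub.ext _ _ _
    simp only [KSub.trunc, KSub.offset, KSub.trunc_zero, KSub.offset_zero, List.map_nil]
    rfl)

end WkCat

/-- `□̂ F`, with `(□̂ F)_Γ⃗ = F_(Γ⃗ ; ·)`. -/
abbrev boxPSh (F : PSh L) : PSh L := (WkCat.next L).op ⋙ F

/-- The terminal presheaf. -/
abbrev unitPSh (L : Logic) : PSh L := (Functor.const _).obj PUnit

theorem map_heq (F : PSh L) {A B B' : WkCat L} (hB : B = B') (f : B ⟶ A) (g : B' ⟶ A)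
    (hfg : f.1 = g.1) (x : F.obj (op A)) : HEq (F.map f.op x) (F.map g.op x) := by
  subst hB
  rw [Subtype.ext hfg]

/-- The presheaf `Δ⃗ ↦ Σ n < |Δ⃗|, F_(Δ⃗ | n)`, with `n` an unbox level of the system. -/
def truncSum (F : PSh L) : PSh L where
  obj Δ := Σ n : {n : ℕ // n ∈ L.UL ∧ n < Δ.unop.size},
    F.obj (op (Δ.unop.trunc n.1))
  map γ := ↾fun x => ⟨⟨γ.unop.1.offset x.1.1, γ.unop.2.offset_mem x.1.2.2 x.1.2.1,
    γ.unop.2.offset_lt x.1.2.2⟩, F.map (WkCat.truncHom γ.unop x.1.1 x.1.2.2).op x.2⟩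
  map_id Δ := by
    refine ConcreteCategory.hom_ext _ _ fun x => ?_
    obtain ⟨⟨n, hL, hn⟩, x⟩ := x
    refine Sigma.ext (Subtype.ext (KSub.offset_id _ _ hn)) ?_
    have h := map_heq F (congrArg Δ.unop.trunc (KSub.offset_id Δ.unop n hn))
      (WkCat.truncHom (𝟙 Δ.unop) n hn) (𝟙 (Δ.unop.trunc n))
      (KSub.trunc_id _ _ hn) x
    refine h.trans (heq_of_eq ?_)
    rw [op_id, F.map_id]
    rfl
  map_comp {Δ Δ' Δ''} γ δ := by
    refine ConcreteCategory.hom_ext _ _ fun x => ?_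
    obtain ⟨⟨n, hL, hn⟩, x⟩ := x
    refine Sigma.ext (Subtype.ext (KSub.offset_comp _ _ n)) ?_
    have h := map_heq F
      (congrArg Δ''.unop.trunc (KSub.offset_comp γ.unop.1 δ.unop.1 n))
      (WkCat.truncHom (δ.unop ≫ γ.unop) n hn)
      (WkCat.truncHom δ.unop _ (γ.unop.2.offset_lt hn) ≫ WkCat.truncHom γ.unop n hn)
      (KSub.trunc_comp _ _ n) x
    refine h.trans (heq_of_eq ?_)
    rw [op_comp, F.map_comp]
    rfl

/-! ### Interpretation of types, contexts and context stacks -/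

/-- Interpretation of types. The internal hom `F.functorHom G` of presheaves has as elements over
`Γ` the families, natural in `Δ`, of functions `F_Δ → G_Δ` for all morphisms `Δ ⟶ Γ`. -/
def interpTy (L : Logic) : Ty → PSh L
  | .base => Ne L .base
  | .box T => boxPSh (interpTy L T)
  | .arr S T => (interpTy L S).functorHom (interpTy L T)

/-- Interpretation of local contexts. -/
def interpCtx (L : Logic) : Ctx → PSh L
  | [] => unitPSh L
  | T :: Γ => FunctorToTypes.prod (interpCtx L Γ) (interpTy L T)

/-- Interpretation of the contexts below the topmost one. -/
def interpBelow (L : Logic) : List Ctx → PSh L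
  | [] => unitPSh L
  | G :: Gs => truncSum (FunctorToTypes.prod (interpBelow L Gs) (interpCtx L G))

/-- Interpretation of context stacks: `⟦ε;Γ⟧ = ⊤ × ⟦Γ⟧` and
`⟦Γ⃗;Γ⟧_Δ⃗ = (Σ n < |Δ⃗|, ⟦Γ⃗⟧_(Δ⃗ | n)) × ⟦Γ⟧_Δ⃗`. -/
def interpStack (L : Logic) (Γ : Stack) : PSh L :=
  FunctorToTypes.prod (interpBelow L Γ.below) (interpCtx L Γ.top)

/-- The set `⟦Γ⃗⟧_Δ⃗` of environments. -/
abbrev Env (Γ : Stack) (Δ : WkCat L) : Type := (interpStack L Γ).obj (op Δ)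

/-! ### Truncation of environments -/

/-- Truncation offset of an environment (meaningful for `n < |Γ⃗|` only). -/
def envOffset : (n : ℕ) → (b : List Ctx) → (t : Ctx) → {Δ : WkCat L} → Env ⟨b, t⟩ Δ → ℕ
  | 0, _, _, _, _ => 0
  | _ + 1, [], _, _, _ => 0
  | n + 1, G :: Gs, _, _, ρ => ρ.1.1.1 + envOffset n Gs G ρ.1.2

/-- Truncation of an environment (meaningful for `n < |Γ⃗|` only). -/
def envTrunc : (n : ℕ) → (b : List Ctx) → (t : Ctx) → {Δ : WkCat L} → (ρ : Env ⟨b, t⟩ Δ) →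
    Env (Stack.trunc ⟨b, t⟩ n) (Δ.trunc (envOffset n b t ρ))
  | 0, _, _, _, ρ => ρ
  | _ + 1, [], _, _, _ => (⟨⟩, ⟨⟩)
  | n + 1, G :: Gs, _, Δ, ρ =>
    cast (congrArg (Env (L := L) (Stack.trunc ⟨Gs, G⟩ n)) (Stack.trunc_add Δ _ _).symm)
      (envTrunc n Gs G ρ.1.2)

theorem envOffset_lt (n : ℕ) (b : List Ctx) (t : Ctx) {Δ : WkCat L} (ρ : Env ⟨b, t⟩ Δ) :
    envOffset n b t ρ < Δ.size := by
  induction n generalizing b t Δ with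
  | zero => exact Stack.size_pos _
  | succ n ih =>
    cases b with
    | nil => exact Stack.size_pos _
    | cons G Gs =>
      have h1 := ih Gs G ρ.1.2
      have h2 : ρ.1.1.1 < Δ.size := ρ.1.1.2.2
      have h3 := Stack.size_trunc h2
      simp only [envOffset]
      change _ < (Stack.trunc Δ ρ.1.1.1).size at h1
      rw [h3] at h1
      exact Nat.add_lt_of_lt_sub' h1

theorem envOffset_one_mem (b : List Ctx) (t : Ctx) {Δ : WkCat L} (ρ : Env ⟨b, t⟩ Δ)
    (hn : 1 < Stack.size ⟨b, t⟩) : envOffset 1 b t ρ ∈ L.UL := by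
  cases b with
  | nil => simp [Stack.size] at hn
  | cons G Gs => exact ρ.1.1.2.1

/-- The truncation offset at an unbox level is an unbox level of the same system. -/
theorem envOffset_mem (n : ℕ) (b : List Ctx) (t : Ctx) {Δ : WkCat L} (ρ : Env ⟨b, t⟩ Δ)
    (hn : n < Stack.size ⟨b, t⟩) (hL : n ∈ L.UL) : envOffset n b t ρ ∈ L.UL := by
  cases L with
  | K => obtain rfl : n = 1 := hL; exact envOffset_one_mem b t ρ hn
  | T =>
    obtain rfl | rfl : n = 0 ∨ n = 1 := hL
    · exact Or.inl rfl
    · exact envOffset_one_mem b t ρ hn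
  | K4 =>
    cases n with
    | zero => exact absurd hL (by simp [Logic.UL])
    | succ n =>
      cases b with
      | nil => simp [Stack.size] at hn
      | cons G Gs =>
        have h1 : 1 ≤ (ρ.1.1.1 : ℕ) := ρ.1.1.2.1
        exact Nat.le_add_right_of_le h1
  | S4 => trivial

theorem envTrunc_map (n : ℕ) (b : List Ctx) (t : Ctx) {Δ Δ' : WkCat L} (ρ : Env ⟨b, t⟩ Δ)
    (γ : Δ' ⟶ Δ) :
    (⟨envOffset n b t ((interpStack L ⟨b, t⟩).map γ.op ρ),
      envTrunc n b t ((interpStack L ⟨b, t⟩).map γ.op ρ)⟩ :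
        Σ m : ℕ, Env (Stack.trunc ⟨b, t⟩ n) (Δ'.trunc m)) =
    ⟨γ.1.offset (envOffset n b t ρ), (interpStack L (Stack.trunc ⟨b, t⟩ n)).map
      (WkCat.truncHom γ (envOffset n b t ρ) (envOffset_lt n b t ρ)).op (envTrunc n b t ρ)⟩ := by
  induction n generalizing b t Δ Δ' with
  | zero =>
    have h0 : γ.1.offset 0 = 0 := KSub.offset_zero _
    refine Sigma.ext h0.symm ?_
    exact map_heq (interpStack L ⟨b, t⟩) (congrArg Δ'.trunc h0.symm) γ
      (WkCat.truncHom γ 0 (Stack.size_pos _)) (KSub.trunc_zero _).symm ρ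
  | succ n ih =>
    cases b with
    | nil =>
      have h0 : γ.1.offset 0 = 0 := KSub.offset_zero _
      refine Sigma.ext h0.symm ?_
      exact map_heq (interpStack L ⟨[], []⟩) (congrArg Δ'.trunc h0.symm) γ
        (WkCat.truncHom γ 0 (Stack.size_pos _)) (KSub.trunc_zero _).symm (⟨⟩, ⟨⟩)
    | cons G Gs =>
      obtain ⟨⟨⟨m, hm⟩, ρ'⟩, r⟩ := ρ
      have key := ih Gs G ρ' (WkCat.truncHom γ m hm.2)
      obtain ⟨h1, h2⟩ := Sigma.ext_iff.1 key
      have e : γ.1.offset m + (WkCat.truncHom γ m hm.2).1.offset (envOffset n Gs G ρ') =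
          γ.1.offset (m + envOffset n Gs G ρ') := (KSub.offset_add _ _ _).symm
      refine Sigma.ext ((congrArg (γ.1.offset m + ·) h1).trans e) ?_
      refine HEq.trans (cast_heq _ _) (h2.trans ?_)
      have hlt : m + envOffset n Gs G ρ' < Δ.size :=
        envOffset_lt (n + 1) (G :: Gs) t (Δ := Δ) (⟨⟨m, hm⟩, ρ'⟩, r)
      have gen : ∀ (F : PSh L) (A A' : WkCat L) (hA : A = A') (B B' : WkCat L) (hB : B = B')
          (f : B ⟶ A) (g : B' ⟶ A') (_ : f.1 = g.1) (x : F.obj (op A)) (y : F.obj (op A'))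
          (_ : HEq x y), HEq (F.map f.op x) (F.map g.op y) := by
        intro F A A' hA B B' hB f g hfg x y hxy
        subst hA
        obtain rfl := eq_of_heq hxy
        exact map_heq F hB f g hfg x
      refine gen (interpStack L (Stack.trunc ⟨Gs, G⟩ n)) _ _ (Stack.trunc_add Δ _ _).symm _ _ ?_
        _ (WkCat.truncHom γ (m + envOffset n Gs G ρ') hlt) (KSub.trunc_add _ _ _).symm _ _
        (cast_heq _ _).symm
      exact (Stack.trunc_add Δ' _ _).symm.trans (congrArg Δ'.trunc e)

/-! ### Evaluation -/

/-- Lookup of a variable in the interpretation of its context. -/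
def lookup : {Γ : Ctx} → {x : ℕ} → {T : Ty} → HasVar Γ x T → (interpCtx L Γ ⟶ interpTy L T)
  | _, _, _, .here => FunctorToTypes.prod.snd
  | _, _, _, .there v => FunctorToTypes.prod.fst ≫ lookup v

/-- The environment `((1, ρ⃗), *)` over `Δ⃗ ; ·`. -/
def extEnv {Γ : Stack} {Δ : WkCat L} (ρ : Env Γ Δ) : Env (Γ.push []) (Δ.push []) :=
  (⟨⟨1, L.one_mem, Stack.one_lt_size_push _ _⟩, ρ⟩, ⟨⟩)

/-- `⟦box t⟧_Δ⃗ (ρ⃗) = ⟦t⟧_(Δ⃗;·) ((1, ρ⃗), *)`. -/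
def evalBox {Γ : Stack} {F : PSh L} (f : interpStack L (Γ.push []) ⟶ F) :
    interpStack L Γ ⟶ boxPSh F where
  app Δ := ↾fun ρ => f.app (op (Δ.unop.push [])) (extEnv ρ)
  naturality Δ Δ' γ := by
    refine ConcreteCategory.hom_ext _ _ fun ρ => ?_
    refine Eq.trans ?_ (NatTrans.naturality_apply f ((WkCat.next L).map γ.unop).op (extEnv ρ))
    refine congrArg (f.app (op (Δ'.unop.push []))) ?_
    refine Prod.ext ?_ rfl
    refine Sigma.ext (Subtype.ext ?_) ?_
    · exact (congrArg (1 + ·) (KSub.offset_zero γ.unop.1)).symm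
    · refine map_heq (interpStack L Γ) ?_ γ.unop
        (WkCat.truncHom ((WkCat.next L).map γ.unop) 1 (Stack.one_lt_size_push _ _)) ?_ ρ
      · exact congrArg (fun k => (Stack.trunc (Δ'.unop.push []) (1 + k) : WkCat L))
          (KSub.offset_zero γ.unop.1).symm
      · exact (KSub.trunc_zero γ.unop.1).symm

/-- `⟦unbox n t⟧_Δ⃗ (ρ⃗) = ⟦t⟧_(Δ⃗|m) (ρ⃗|n) [id⃗ ; ⇑ᵐ]`, where `m` is the truncation offset of `ρ⃗`
at `n`. -/
def evalUnbox {Γ : Stack} {F : PSh L} (n : ℕ) (hL : n ∈ L.UL) (hn : n < Γ.size)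
    (f : interpStack L (Γ.trunc n) ⟶ boxPSh F) : interpStack L Γ ⟶ F where
  app Δ := ↾fun ρ =>
    F.map (Δ.unop.idExt (envOffset n Γ.below Γ.top ρ)
        (envOffset_mem n Γ.below Γ.top ρ hn hL) (envOffset_lt n Γ.below Γ.top ρ)).op
      (f.app (op (Δ.unop.trunc (envOffset n Γ.below Γ.top ρ))) (envTrunc n Γ.below Γ.top ρ))
  naturality Δ Δ' γ := by
    refine ConcreteCategory.hom_ext _ _ fun ρ => ?_
    have key := envTrunc_map n Γ.below Γ.top (Δ := Δ.unop) (Δ' := Δ'.unop) ρ γ.unop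
    have gen : ∀ (p q : Σ m : ℕ, Env (Γ.trunc n) (Δ'.unop.trunc m)) (hp : p.1 ∈ L.UL)
        (hq : q.1 ∈ L.UL) (hp' : p.1 < Δ'.unop.size) (hq' : q.1 < Δ'.unop.size), p = q →
        F.map (Δ'.unop.idExt p.1 hp hp').op (f.app (op (Δ'.unop.trunc p.1)) p.2) =
          F.map (Δ'.unop.idExt q.1 hq hq').op (f.app (op (Δ'.unop.trunc q.1)) q.2) := by
      rintro p q hp hq hp' hq' rfl
      rfl
    have hm := envOffset_mem n Γ.below Γ.top (Δ := Δ.unop) ρ hn hL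
    have hm' := envOffset_lt n Γ.below Γ.top (Δ := Δ.unop) ρ
    refine (gen _ _ (envOffset_mem n Γ.below Γ.top _ hn hL) (γ.unop.2.offset_mem hm' hm)
      (envOffset_lt n Γ.below Γ.top _) (γ.unop.2.offset_lt hm') key).trans ?_
    have nat := NatTrans.naturality_apply f
      (WkCat.truncHom γ.unop (envOffset n Γ.below Γ.top ρ) hm').op (envTrunc n Γ.below Γ.top ρ)
    refine (congrArg _ nat).trans ?_
    refine (Functor.map_comp_apply F _ _ _).symm.trans ?_
    refine Eq.trans ?_ (Functor.map_comp_apply F _ _ _)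
    refine congrArg (fun g => F.map (Quiver.Hom.op g) _) ?_
    refine Subtype.ext ?_
    have h := γ.unop.2.trunc hm'
    change KSub.ext (KSub.comp (γ.unop.1.trunc _) (KSub.trunc (KSub.id _) 0))
        (_ + KSub.offset (KSub.id _) 0) [] =
      KSub.ext (KSub.comp (KSub.id _) (γ.unop.1.trunc _)) _ []
    rw [KSub.trunc_zero, KSub.comp_id h.isRen, h.id_comp, KSub.offset_zero]
    rfl

/-- The environment `(π, (ρ, a))`, where `(π, ρ) = ρ⃗`. -/
def bindEnv {Γ : Stack} {Δ : WkCat L} {S : Ty} (ρ : Env Γ Δ) (a : (interpTy L S).obj (op Δ)) :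
    Env (Γ.bind S) Δ :=
  (ρ.1, (ρ.2, a))

/-- `⟦λ x. t⟧_Δ⃗ (ρ⃗) = (γ⃗, a) ↦ ⟦t⟧ (π, (ρ, a))`, where `(π, ρ) = ρ⃗[γ⃗]`. -/
def evalLam {Γ : Stack} {S T : Ty} (f : interpStack L (Γ.bind S) ⟶ interpTy L T) :
    interpStack L Γ ⟶ interpTy L (.arr S T) where
  app Δ := ↾fun ρ =>
    { app := fun Δ' γ => ↾fun a => f.app Δ' (bindEnv ((interpStack L Γ).map γ ρ) a)
      naturality := fun {Δ' Δ''} δ γ => by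
        refine ConcreteCategory.hom_ext _ _ fun a => ?_
        refine Eq.trans ?_ (NatTrans.naturality_apply f δ _)
        have h := Functor.map_comp_apply (interpStack L Γ) γ δ ρ
        exact congrArg (fun r => f.app Δ'' (bindEnv r ((interpTy L S).map δ a))) h }
  naturality Δ Δ' γ := by
    refine ConcreteCategory.hom_ext _ _ fun ρ => ?_
    refine Functor.functorHom_ext fun Ψ δ => ?_
    refine ConcreteCategory.hom_ext _ _ fun a => ?_
    have h := Functor.map_comp_apply (interpStack L Γ) γ δ ρ
    exact (congrArg (fun r => f.app Ψ (bindEnv r a)) h).symm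

/-- Applying an element of the presheaf exponential. -/
def applyHom {F G : PSh L} {Γ Δ : (WkCat L)ᵒᵖ} (a : (F.functorHom G).obj Γ) (γ : Γ ⟶ Δ)
    (b : F.obj Δ) : G.obj Δ :=
  Functor.HomObj.app a Δ γ b

theorem applyHom_map {F G : PSh L} {Γ Γ' Δ : (WkCat L)ᵒᵖ} (a : (F.functorHom G).obj Γ)
    (γ : Γ ⟶ Γ') (δ : Γ' ⟶ Δ) (b : F.obj Δ) :
    applyHom ((F.functorHom G).map γ a) δ b = applyHom a (γ ≫ δ) b :=
  rfl

theorem map_applyHom {F G : PSh L} {Γ Δ Δ' : (WkCat L)ᵒᵖ} (a : (F.functorHom G).obj Γ)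
    (γ : Γ ⟶ Δ) (δ : Δ ⟶ Δ') (b : F.obj Δ) :
    G.map δ (applyHom a γ b) = applyHom a (γ ≫ δ) (F.map δ b) :=
  (ConcreteCategory.congr_hom (Functor.HomObj.naturality a δ γ) b).symm

/-- `⟦t s⟧_Δ⃗ (ρ⃗) = ⟦t⟧_Δ⃗ (ρ⃗) (id⃗, ⟦s⟧_Δ⃗ (ρ⃗))`. -/
def evalApp {Γ : Stack} {S T : Ty} (f : interpStack L Γ ⟶ interpTy L (.arr S T))
    (g : interpStack L Γ ⟶ interpTy L S) : interpStack L Γ ⟶ interpTy L T where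
  app Δ := ↾fun ρ => applyHom (f.app Δ ρ) (𝟙 Δ) (g.app Δ ρ)
  naturality Δ Δ' γ := by
    refine ConcreteCategory.hom_ext _ _ fun ρ => ?_
    have hf := NatTrans.naturality_apply f γ ρ
    have hg := NatTrans.naturality_apply g γ ρ
    refine Eq.trans ?_ (map_applyHom (f.app Δ ρ) (𝟙 Δ) γ (g.app Δ ρ)).symm
    refine (congrArg₂ (fun r b => applyHom (F := interpTy L S) (G := interpTy L T) r (𝟙 Δ') b)
      hf hg).trans ?_
    refine (applyHom_map (f.app Δ ρ) γ (𝟙 Δ') _).trans ?_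
    rw [Category.comp_id, Category.id_comp]

/-- Evaluation of well-typed terms to natural transformations. -/
def eval : {Γ : Stack} → {t : Exp} → {T : Ty} → Typing L Γ t T →
    (interpStack L Γ ⟶ interpTy L T)
  | _, _, _, .var v => FunctorToTypes.prod.snd ≫ lookup v
  | _, _, _, .box d => evalBox (eval d)
  | _, _, _, .unbox hL hn d => evalUnbox _ hL hn (eval d)
  | _, _, _, .lam d => evalLam (eval d)
  | _, _, _, .app d e => evalApp (eval d) (eval e)

/-! ### Reification and reflection -/

/-- `↓^(□ T)_Γ⃗ (a) = box (↓^T_(Γ⃗;·) (a))`. -/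
def reifyBox {F : PSh L} {T : Ty} (d : F ⟶ Nf L T) : boxPSh F ⟶ Nf L (.box T) where
  app Γ := ↾fun a =>
    let w := d.app (op (Γ.unop.push [])) a
    ⟨.box w.1, .box w.2.1, w.2.2.map .box⟩
  naturality Γ Γ' γ := by
    refine ConcreteCategory.hom_ext _ _ fun a => Subtype.ext ?_
    exact congrArg (fun w => Exp.box w.1)
      (NatTrans.naturality_apply d ((WkCat.next L).map γ.unop).op a)

/-- `↑^(□ T)_Γ⃗ (v) = ↑^T_(Γ⃗;·) (unbox 1 v)`. -/
def reflectBox {F : PSh L} {T : Ty} (u : Ne L T ⟶ F) : Ne L (.box T) ⟶ boxPSh F where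
  app Γ := ↾fun v => u.app (op (Γ.unop.push []))
    ⟨.unbox 1 v.1, .unbox 1 v.2.1,
      v.2.2.map (.unbox (Γ := Γ.unop.push []) L.one_mem (Stack.one_lt_size_push _ _))⟩
  naturality Γ Γ' γ := by
    refine ConcreteCategory.hom_ext _ _ fun v => ?_
    refine Eq.trans ?_ (NatTrans.naturality_apply u ((WkCat.next L).map γ.unop).op _)
    refine congrArg (u.app (op (Γ'.unop.push []))) (Subtype.ext ?_)
    change Exp.unbox 1 _ = Exp.unbox (1 + KSub.offset γ.unop.1 0) (Exp.sub _ (KSub.trunc γ.unop.1 0))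
    rw [KSub.offset_zero, KSub.trunc_zero]
    rfl

/-- The most recent variable as a neutral term. -/
def neVar (Γ : WkCat L) (S : Ty) : (Ne L S).obj (op (Γ.bind S)) :=
  ⟨.var 0, .var 0, ⟨.var .here⟩⟩

/-- `↓^(S ⟶ T)_(Γ⃗;Γ) (a) = λ x. ↓^T_(Γ⃗;Γ,x:S) (a (p(id⃗), ↑^S_(Γ⃗;Γ,x:S) (x)))`. -/
def reifyArr {F G : PSh L} {S T : Ty} (u : Ne L S ⟶ F) (d : G ⟶ Nf L T) :
    F.functorHom G ⟶ Nf L (.arr S T) where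
  app Γ := ↾fun a =>
    let w := d.app (op (Γ.unop.bind S))
      (applyHom a (Γ.unop.pId S).op (u.app (op (Γ.unop.bind S)) (neVar Γ.unop S)))
    ⟨.lam w.1, .lam w.2.1, w.2.2.map .lam⟩
  naturality Γ Γ' γ := by
    refine ConcreteCategory.hom_ext _ _ fun a => Subtype.ext ?_
    let q := (WkCat.q γ.unop S).op
    let x := u.app (op (Γ.unop.bind S)) (neVar Γ.unop S)
    have hx : F.map q x = u.app (op (Γ'.unop.bind S)) (neVar Γ'.unop S) := by
      refine (NatTrans.naturality_apply u q (neVar Γ.unop S)).symm.trans ?_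
      refine congrArg (u.app (op (Γ'.unop.bind S))) (Subtype.ext ?_)
      change Exp.sub (.var 0) (KSub.lift _) = .var 0
      simp [Exp.sub, KSub.lift, KSub.top_snoc]
    have hγ : (Γ.unop.pId S).op ≫ q = γ ≫ (Γ'.unop.pId S).op := by
      refine Quiver.Hom.unop_inj (Subtype.ext ?_)
      change (KSub.id _).weaken.comp γ.unop.1.lift = γ.unop.1.comp (KSub.id _).weaken
      rw [KSub.weaken_comp_lift (IsKWk.id L Γ.unop).isRen γ.unop.2, γ.unop.2.id_comp,
        KSub.comp_weaken γ.unop.2.isRen (IsKWk.id L Γ'.unop), KSub.comp_id γ.unop.2.isRen]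
    have h1 := NatTrans.naturality_apply d q (applyHom a (Γ.unop.pId S).op x)
    rw [map_applyHom, hx, hγ] at h1
    exact congrArg (fun w => Exp.lam w.1) h1

/-- `↑^(S ⟶ T)_(Γ⃗;Γ) (v) = (γ⃗, a) ↦ ↑^T_Δ⃗ (v[γ⃗] (↓^S_Δ⃗ (a)))`. -/
def reflectArr {F G : PSh L} {S T : Ty} (d : F ⟶ Nf L S) (u : Ne L T ⟶ G) :
    Ne L (.arr S T) ⟶ F.functorHom G where
  app Γ := ↾fun v =>
    { app := fun Δ γ => ↾fun a =>
        let v' := (Ne L (.arr S T)).map γ v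
        let w := d.app Δ a
        u.app Δ ⟨.app v'.1 w.1, .app v'.2.1 w.2.1,
          v'.2.2.elim fun dv => w.2.2.map fun dw => .app dv dw⟩
      naturality := fun {Δ Δ'} δ γ => by
        refine ConcreteCategory.hom_ext _ _ fun a => ?_
        refine Eq.trans ?_ (NatTrans.naturality_apply u δ _)
        have h1 := NatTrans.naturality_apply d δ a
        have h2 := Functor.map_comp_apply (Ne L (.arr S T)) γ δ v
        exact congrArg (u.app Δ') (Subtype.ext (congrArg₂ Exp.app (congrArg Subtype.val h2)
          (congrArg Subtype.val h1))) }
  naturality Γ Γ' γ := by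
    refine ConcreteCategory.hom_ext _ _ fun v => ?_
    refine Functor.functorHom_ext fun Ψ δ => ?_
    refine ConcreteCategory.hom_ext _ _ fun a => ?_
    have h := Functor.map_comp_apply (Ne L (.arr S T)) γ δ v
    exact congrArg (u.app Ψ) (Subtype.ext (congrArg (fun k => Exp.app k _)
      (congrArg Subtype.val h).symm))

mutual
/-- Reification `↓^T : ⟦T⟧ ⟶ Nf T`. -/
def reify (L : Logic) : (T : Ty) → (interpTy L T ⟶ Nf L T)
  | .base => { app := fun _ => ↾fun v => ⟨v.1, .ne v.2.1, v.2.2⟩ }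
  | .box T => reifyBox (reify L T)
  | .arr S T => reifyArr (reflect L S) (reify L T)
/-- Reflection `↑^T : Ne T ⟶ ⟦T⟧`. -/
def reflect (L : Logic) : (T : Ty) → (Ne L T ⟶ interpTy L T)
  | .base => 𝟙 _
  | .box T => reflectBox (reflect L T)
  | .arr S T => reflectArr (reify L S) (reflect L T)
end

/-! ### Normalization by evaluation -/

/-- Extend an identity environment from `b ; ·` to `b ; t`, one variable at a time. -/
def idEnvTop (b : List Ctx) (e : Env (L := L) ⟨b, []⟩ (⟨b, []⟩ : Stack)) :
    (t : Ctx) → Env (L := L) ⟨b, t⟩ (⟨b, t⟩ : Stack)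
  | [] => e
  | T :: t =>
    let Γ : WkCat L := (⟨b, t⟩ : Stack)
    let ρ : Env (L := L) ⟨b, t⟩ (Γ.bind T) :=
      (interpStack L ⟨b, t⟩).map (Γ.pId T).op (idEnvTop b e t)
    (ρ.1, (ρ.2, (reflect L T).app (op (Γ.bind T)) (neVar Γ T)))

/-- The identity environment for a stack whose topmost context is empty. -/
def idEnvNil : (b : List Ctx) → Env (L := L) ⟨b, []⟩ (⟨b, []⟩ : Stack)
  | [] => (⟨⟩, ⟨⟩)
  | G :: Gs => extEnv (idEnvTop Gs (idEnvNil Gs) G)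

/-- The identity environment `↑^Γ⃗ ∈ ⟦Γ⃗⟧_Γ⃗`. -/
def idEnv (L : Logic) (Γ : Stack) : Env (L := L) Γ Γ :=
  idEnvTop Γ.below (idEnvNil Γ.below) Γ.top

/-- Normalization by evaluation: `nbe^T_Γ⃗ (t) = ↓^T_Γ⃗ (⟦t⟧_Γ⃗ (↑^Γ⃗))`, a normal form of type `T`
in `Γ⃗`. As terms carry no type annotations, it takes the typing derivation as its argument. -/
def nbe {Γ : Stack} {t : Exp} {T : Ty} (d : Typing L Γ t T) :
    {w : Exp // IsNf w ∧ Nonempty (Typing L Γ w T)} :=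
  (reify L T).app (op (Γ : WkCat L)) ((eval d).app (op (Γ : WkCat L)) (idEnv L Γ))

end LamBox

-- The argument is a Kripke logical relation (gluing) between terms and elements of the presheaf
-- model. At base type, a term is related to the neutrals it is equivalent to. At `□ T`, it is
-- related to `a` when its `unbox 1` is related to `a` in the next world. At a function type,
-- related arguments must go to related results in every world reached by a K-weakening.
--
-- The relation is invariant under judgmental equivalence (`Glue.congr`) and monotone along
-- K-weakenings (`Glue.map`). By `glue_reflect_reify`, reflection produces related elements and
-- every related pair satisfies `t ≈ ↓a`; the η rules drive this. By `glue_eval`, `t[σ⃗]` is related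
-- to `⟦t⟧(ρ⃗)` whenever `σ⃗` is related to `ρ⃗`; the β rules drive this. The identity substitution
-- is related to the identity environment (`glueEnv_idEnv`), so `t = t[id⃗]` is related to its value
-- and hence equivalent to its normal form.
--
-- The box clause mentions only level 1. That suffices for every level `m`, because `(unbox 1
-- t)[id⃗;⇑ᵐ]` is `unbox m t` and the relation is monotone.
--
-- What remains is the algebra of substitution. Both `congr` and `map` need `≈` to be stable under
-- K-weakenings (`TmEquiv.sub`), and stability of the β rules needs weakenings to compose with the
-- substitutions occurring in them. The composition law `Typing.sub_comp_wt` is proved for all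
-- well-typed K-substitutions. Two points need care: weakening passes through zero offsets into
-- lower local substitutions, and the raw shift in the function η rule must be identified with a
-- K-weakening (`Typing.wk_eq`). The four systems enter through closure of the unbox levels under
-- truncation offsets and through 1 being a level.

namespace LamBox

variable {L : Logic}

/-! ### Shifting as a K-weakening -/

/-- `γ` is the K-weakening of `Δ` by one variable with index `c` in the context that lies `l`
contexts below the topmost one. -/
inductive IsShift : ℕ → ℕ → KSub → Stack → Prop
  | zero (Δ : Stack) : IsShift 0 0 (KSub.id Δ).weaken Δ
  | bind {l c : ℕ} {γ : KSub} {Δ : Stack} (T : Ty) :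
      IsShift l c γ Δ → IsShift l (if l = 0 then c + 1 else c) γ.lift (Δ.bind T)
  | push {l c : ℕ} {γ : KSub} {Δ : Stack} :
      IsShift l c γ Δ → IsShift (l + 1) c (γ.ext 1 []) (Δ.push [])

namespace IsShift

variable {l c : ℕ} {γ : KSub} {Δ : Stack}

theorem offset (h : IsShift l c γ Δ) {n : ℕ} (hn : n < Δ.size) : γ.offset n = n := by
  induction h generalizing n with
  | zero Δ => rw [KSub.offset_weaken, KSub.offset_id _ _ hn]
  | bind T h ih => rw [KSub.offset_lift, ih hn]
  | push h ih =>
    cases n with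
    | zero => rfl
    | succ n => rw [KSub.offset, ih (Nat.lt_of_succ_lt_succ hn), Nat.add_comm]

theorem trunc (h : IsShift l c γ Δ) {n : ℕ} (hn : n < Δ.size) (hl : n ≤ l) :
    IsShift (l - n) c (γ.trunc n) (Δ.trunc n) := by
  induction h generalizing n with
  | zero Δ =>
    obtain rfl : n = 0 := by omega
    rw [KSub.trunc_zero]
    exact .zero Δ
  | @bind l c γ Δ T h ih =>
    cases n with
    | zero => rw [KSub.trunc_zero]; exact h.bind T
    | succ n =>
      -- Lifting affects a truncation only across total offset zero. A shift has the offsets of the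
      -- identity, so the truncation is untouched.
      have h0 : γ.offset (n + 1) ≠ 0 := by rw [h.offset hn]; omega
      rw [KSub.trunc_lift, if_neg h0, Stack.trunc_bind, if_neg (by omega)]
      exact ih hn hl
  | push h ih =>
    cases n with
    | zero => exact h.push
    | succ n =>
      rw [Nat.add_sub_add_right]
      exact ih (Nat.lt_of_succ_lt_succ hn) (by omega)

/-- Only the context at depth `l` changes. Since offsets equal depths, no weakening leaks further
down. -/
theorem trunc_eq_id (h : IsShift l c γ Δ) {n : ℕ} (hn : n < Δ.size) (hl : l < n) :
    γ.trunc n = KSub.id (Δ.trunc n) := by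
  induction h generalizing n with
  | zero Δ =>
    rw [KSub.trunc_weaken, KSub.offset_id _ _ hn, if_neg (by omega), KSub.trunc_id _ _ hn]
  | @bind l c γ Δ T h ih =>
    obtain ⟨n, rfl⟩ := Nat.exists_eq_succ_of_ne_zero (Nat.ne_zero_of_lt hl)
    have h0 : γ.offset (n + 1) ≠ 0 := by rw [h.offset hn]; omega
    rw [Nat.succ_eq_add_one, KSub.trunc_lift, if_neg h0, Stack.trunc_bind]
    exact ih hn hl
  | push h ih =>
    obtain ⟨n, rfl⟩ := Nat.exists_eq_succ_of_ne_zero (Nat.ne_zero_of_lt hl)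
    exact ih (Nat.lt_of_succ_lt_succ hn) (by omega)

theorem top_getElem? (h : IsShift l c γ Δ) {x : ℕ} (hx : x < Δ.top.length) :
    γ.top[x]? = some ((Exp.var x).shift l c) := by
  induction h generalizing x with
  | zero Δ => simp [KSub.top_weaken, KSub.top_id, KSub.localId, hx]
  | @bind l c γ Δ T h ih =>
    cases x with
    | zero => by_cases hl : l = 0 <;> simp [KSub.lift, KSub.top_snoc, Exp.shift, hl]
    | succ x =>
      have := ih (Nat.lt_of_succ_lt_succ hx)
      by_cases hl : l = 0 <;> by_cases hc : c ≤ x <;>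
        simp_all [KSub.lift, KSub.top_snoc, KSub.top_weaken, Exp.shift]
  | push => simp [Stack.push] at hx

end IsShift

/-- The recursion of `shift` matches the rules of `IsShift`: `box` uses `push`, a binder uses
`bind`. At `unbox`, the truncation is a shift again if the marked context survives, and the identity
otherwise. -/
theorem Typing.sub_isShift {Δ : Stack} {t : Exp} {T : Ty} (d : Typing L Δ t T) {l c : ℕ}
    {γ : KSub} (h : IsShift l c γ Δ) : t.sub γ = t.shift l c := by
  induction d generalizing l c γ with
  | var v => simp [Exp.sub, h.top_getElem? v.lt_length]
  | box d ih => exact congrArg Exp.box (ih h.push)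
  | unbox hL hn d ih =>
    rw [Exp.sub, Exp.shift, h.offset hn]
    split_ifs with hl
    · rw [ih (h.trunc hn hl)]
    · rw [h.trunc_eq_id hn (by omega), d.sub_id]
  | lam d ih => exact congrArg Exp.lam (ih (h.bind _))
  | app d e ihd ihe => rw [Exp.sub, Exp.shift, ihd h, ihe h]

/-- This trades the raw shift for a K-weakening, so that composition laws apply to it. -/
theorem Typing.wk_eq {Δ : Stack} {t : Exp} {T : Ty} (d : Typing L Δ t T) :
    t.wk = t.sub (KSub.id Δ).weaken :=
  (d.sub_isShift (.zero Δ)).symm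

theorem Typing.nonempty_wk {Δ : Stack} {t : Exp} {T : Ty} (d : Typing L Δ t T) (S : Ty) :
    Nonempty (Typing L (Δ.bind S) t.wk T) := by
  rw [d.wk_eq]
  exact d.nonempty_sub ((IsKWk.id L Δ).p S)

/-! ### Well-typed K-substitutions -/

/-- A well-typed local substitution; if `V` holds, all its terms are variables. -/
def WtLocal (L : Logic) (V : Prop) (σ : List Exp) (Γ : Stack) (D : Ctx) : Prop :=
  List.Forall₂ (fun t T => (V → ∃ y, t = .var y) ∧ Nonempty (Typing L Γ t T)) σ D

/-- Well-typed K-substitutions `Γ ⇒ Δ`; if `V` holds, all their terms are variables. -/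
inductive Wt (L : Logic) (V : Prop) : KSub → Stack → Stack → Prop
  | base {σ : List Exp} {Γ : Stack} {D : Ctx} : WtLocal L V σ Γ D → Wt L V (.base σ) Γ ⟨[], D⟩
  | ext {s : KSub} {n : ℕ} {σ : List Exp} {Γ Δ : Stack} {D : Ctx} : n ∈ L.UL → n < Γ.size →
      Wt L V s (Γ.trunc n) Δ → WtLocal L V σ Γ D → Wt L V (.ext s n σ) Γ (Δ.push D)

theorem WtLocal.weaken {V : Prop} {σ : List Exp} {Γ : Stack} {D : Ctx} (h : WtLocal L V σ Γ D)
    (S : Ty) : WtLocal L V (σ.map Exp.wk) (Γ.bind S) D := by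
  refine List.forall₂_map_left_iff.2 (h.imp fun t T ht => ⟨fun hV => ?_, ?_⟩)
  · obtain ⟨y, rfl⟩ := ht.1 hV
    exact ⟨y + 1, by simp [Exp.wk, Exp.shift]⟩
  · exact ht.2.elim fun d => d.nonempty_wk S

namespace Wt

variable {V V' : Prop} {γ δ σ : KSub} {Γ Δ Ψ : Stack}

theorem top (h : Wt L V σ Γ Δ) : WtLocal L V σ.top Γ Δ.top := by
  cases h <;> assumption

theorem top_length (h : Wt L V σ Γ Δ) : σ.top.length = Δ.top.length := h.top.length_eq

theorem weaken (h : Wt L V σ Γ Δ) (S : Ty) : Wt L V σ.weaken (Γ.bind S) Δ := by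
  induction h with
  | base h => exact .base (h.weaken S)
  | @ext s n σ Γ Δ D hL hn h hσ ih =>
    refine .ext hL hn ?_ (hσ.weaken S)
    -- At offset zero the next local substitution lives in the context just extended and is weakened
    -- too. At a positive offset, truncation discards that context.
    split_ifs with h0
    · subst h0
      exact ih
    · obtain ⟨k, rfl⟩ := Nat.exists_eq_succ_of_ne_zero h0
      rw [Nat.succ_eq_add_one, Stack.trunc_bind]
      exact h

theorem snoc (h : Wt L V σ Γ Δ) {t : Exp} {S : Ty} (hV : V → ∃ y, t = .var y)
    (d : Typing L Γ t S) : Wt L V (σ.snoc t) Γ (Δ.bind S) := by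
  cases h with
  | base h => exact .base (.cons ⟨hV, ⟨d⟩⟩ h)
  | ext hL hn h hσ => exact .ext hL hn h (.cons ⟨hV, ⟨d⟩⟩ hσ)

theorem lift (h : Wt L V σ Γ Δ) (S : Ty) : Wt L V σ.lift (Γ.bind S) (Δ.bind S) :=
  (h.weaken S).snoc (fun _ => ⟨0, rfl⟩) (.var .here)

theorem push (h : Wt L V σ Γ Δ) : Wt L V (σ.ext 1 []) (Γ.push []) (Δ.push []) :=
  .ext L.one_mem (Stack.one_lt_size_push _ _) h .nil

theorem trunc_aux (h : Wt L V σ Γ Δ) {n : ℕ} (hn : n < Δ.size) :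
    σ.offset n < Γ.size ∧ Wt L V (σ.trunc n) (Γ.trunc (σ.offset n)) (Δ.trunc n) := by
  induction h generalizing n with
  | base h =>
    obtain rfl : n = 0 := by simpa [Stack.size] using hn
    exact ⟨Stack.size_pos _, .base h⟩
  | ext hL hlt h hσ ih =>
    cases n with
    | zero => exact ⟨Stack.size_pos _, .ext hL hlt h hσ⟩
    | succ n =>
      obtain ⟨h1, h2⟩ := ih (n := n) (by simpa [Stack.size_push] using hn)
      rw [Stack.size_trunc hlt] at h1
      simp only [KSub.offset, KSub.trunc, Stack.trunc_push]
      rw [Stack.trunc_add]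
      exact ⟨by omega, h2⟩

theorem offset_lt (h : Wt L V σ Γ Δ) {n : ℕ} (hn : n < Δ.size) : σ.offset n < Γ.size :=
  (h.trunc_aux hn).1

theorem trunc (h : Wt L V σ Γ Δ) {n : ℕ} (hn : n < Δ.size) :
    Wt L V (σ.trunc n) (Γ.trunc (σ.offset n)) (Δ.trunc n) :=
  (h.trunc_aux hn).2

theorem offset_one_mem (h : Wt L V σ Γ Δ) (hn : 1 < Δ.size) : σ.offset 1 ∈ L.UL := by
  cases h with
  | base => simp [Stack.size] at hn
  | ext hm => simpa [KSub.offset, KSub.offset_zero] using hm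

/-- Each leading offset lies in `U`, and `U` absorbs the sums that can arise: a single 1 in `K`, at
most one summand in `T`, a positive first summand in `K4`, anything in `S4`. This keeps `unbox`
well-typed under substitution. -/
theorem offset_mem (h : Wt L V σ Γ Δ) {n : ℕ} (hn : n < Δ.size) (hL : n ∈ L.UL) :
    σ.offset n ∈ L.UL := by
  cases L with
  | K => obtain rfl : n = 1 := hL; exact h.offset_one_mem hn
  | T =>
    obtain rfl | rfl : n = 0 ∨ n = 1 := hL
    · rw [KSub.offset_zero]; exact Or.inl rfl
    · exact h.offset_one_mem hn
  | K4 =>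
    obtain ⟨k, rfl⟩ : ∃ k, n = 1 + k := Nat.exists_eq_add_of_le hL
    have h1 : 1 ≤ σ.offset 1 := h.offset_one_mem (by omega)
    rw [KSub.offset_add]
    exact Nat.le_add_right_of_le h1
  | S4 => trivial

theorem nonempty_typing (h : Wt L V σ Γ Δ) {x : ℕ} {T : Ty} (v : HasVar Δ.top x T) :
    Nonempty (Typing L Γ (σ.top.getD x (.var x)) T) := by
  have key : ∀ {σ : List Exp} {D : Ctx}, WtLocal L V σ Γ D → ∀ {x : ℕ}, HasVar D x T →
      Nonempty (Typing L Γ (σ.getD x (.var x)) T) := by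
    intro σ D h
    -- The default must be decoupled from the index: the index decreases along the list while the
    -- default stays fixed.
    have : ∀ {x : ℕ} (y : ℕ), HasVar D x T → Nonempty (Typing L Γ (σ.getD x (.var y)) T) := by
      induction h with
      | nil => intro x y v; cases v
      | cons h _ ih =>
        intro x y v
        cases v with
        | here => exact h.2
        | there v => simpa using ih y v
    exact fun {_} v => this _ v
  exact key h.top v

end Wt

theorem IsKWk.wt {γ : KSub} {Γ Δ : Stack} (h : IsKWk L γ Γ Δ) (V : Prop) : Wt L V γ Γ Δ := by
  induction h with
  | nil => exact .base .nil
  | q T _ ih => exact ih.lift T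
  | p T _ ih => exact ih.weaken T
  | ext hL hn _ ih => exact .ext hL hn ih .nil

/-- The substitution lemma. -/
theorem Typing.nonempty_sub_wt {V : Prop} {σ : KSub} {Γ Δ : Stack} {t : Exp} {T : Ty}
    (d : Typing L Δ t T) (h : Wt L V σ Γ Δ) : Nonempty (Typing L Γ (t.sub σ) T) := by
  induction d generalizing σ Γ with
  | var v => exact h.nonempty_typing v
  | box d ih => exact (ih h.push).map .box
  | unbox hL hn d ih => exact (ih (h.trunc hn)).map (.unbox (h.offset_mem hn hL) (h.offset_lt hn))
  | lam d ih => exact (ih (h.lift _)).map .lam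
  | app d e ihd ihe => exact (ihd h).elim fun d' => (ihe h).map fun e' => .app d' e'

/-! ### The algebra of well-typed K-substitutions -/

theorem WtLocal.map_congr {V : Prop} {σ : List Exp} {Γ : Stack} {D : Ctx}
    (h : WtLocal L V σ Γ D) {f g : Exp → Exp}
    (hfg : ∀ t T, (V → ∃ y, t = .var y) → Typing L Γ t T → f t = g t) : σ.map f = σ.map g := by
  induction h with
  | nil => rfl
  | cons h _ ih => rw [List.map_cons, List.map_cons, ih, h.2.elim fun d => hfg _ _ h.1 d]

namespace Wt

variable {V V' : Prop} {γ δ σ : KSub} {Γ Δ Ψ : Stack}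

theorem comp_id (h : Wt L V σ Γ Δ) : σ.comp (KSub.id Γ) = σ := by
  have key : ∀ {σ Γ D}, WtLocal L V σ Γ D → (σ.map fun t => t.sub (KSub.id Γ)) = σ := fun h =>
    (h.map_congr fun t T _ d => d.sub_id).trans (List.map_id _)
  induction h with
  | base h => rw [KSub.comp, key h]
  | ext hL hn h hσ ih =>
    rw [KSub.comp, key hσ, KSub.offset_id _ _ hn, KSub.trunc_id _ _ hn, ih]

theorem id_comp (h : Wt L V σ Γ Δ) : (KSub.id Δ).comp σ = σ := by
  induction h with
  | base h => exact congrArg KSub.base (KSub.localId_map_sub h.length_eq)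
  | @ext s n σ Γ Δ D hL hn h hσ ih =>
    have e := KSub.localId_map_sub (Γ := D) (γ := .ext s n σ) hσ.length_eq
    change KSub.ext ((KSub.id Δ).comp (s.trunc 0)) (n + s.offset 0)
      ((KSub.localId D).map _) = _
    rw [KSub.trunc_zero, KSub.offset_zero, ih, e]
    rfl

variable (L V V') in
/-- Substituting with a K-substitution satisfying `V'` in a term that may occur in one
satisfying `V` commutes with weakening. -/
def SubComm : Prop :=
  ∀ ⦃δ : KSub⦄ ⦃Γ Ψ : Stack⦄ ⦃t : Exp⦄ ⦃T : Ty⦄, (V → ∃ y, t = .var y) → Typing L Γ t T →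
    Wt L V' δ Ψ Γ →
    t.sub δ.weaken = (t.sub δ).wk ∧
      ∀ u S, (V' → ∃ y, u = .var y) → Typing L Ψ u S → t.wk.sub (δ.snoc u) = t.sub δ

/-- On both sides the weakening continues downwards exactly when the offset of `δ` at the current
level is zero. -/
theorem comp_weaken_of (hc : SubComm L V V') (h : Wt L V γ Γ Δ) (hδ : Wt L V' δ Ψ Γ) :
    γ.comp δ.weaken = (γ.comp δ).weaken := by
  have key : ∀ {σ Γ D δ Ψ}, WtLocal L V σ Γ D → Wt L V' δ Ψ Γ →
      (σ.map fun t => t.sub δ.weaken) = (σ.map fun t => t.sub δ).map Exp.wk := fun h hδ => by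
    rw [List.map_map]
    exact h.map_congr fun t T hV d => (hc hV d hδ).1
  induction h generalizing δ Ψ with
  | base h => rw [KSub.comp, key h hδ, KSub.comp, KSub.weaken]
  | ext hL hn h hσ ih =>
    simp only [KSub.comp, KSub.weaken, KSub.offset_weaken, KSub.trunc_weaken, key hσ hδ]
    split_ifs with h0
    · rw [ih (hδ.trunc hn)]
    · rfl

theorem weaken_comp_snoc_of (hc : SubComm L V V') (h : Wt L V γ Γ Δ) (hδ : Wt L V' δ Ψ Γ)
    {u : Exp} {S : Ty} (hu : V' → ∃ y, u = .var y) (du : Typing L Ψ u S) :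
    γ.weaken.comp (δ.snoc u) = γ.comp δ := by
  have key : ∀ {σ Γ D δ}, WtLocal L V σ Γ D → Wt L V' δ Ψ Γ →
      ((σ.map Exp.wk).map fun t => t.sub (δ.snoc u)) = σ.map fun t => t.sub δ := fun h hδ => by
    rw [List.map_map]
    exact h.map_congr fun t T hV d => (hc hV d hδ).2 u S hu du
  induction h generalizing δ with
  | base h => rw [KSub.weaken, KSub.comp, key h hδ, KSub.comp]
  | @ext s n σ Γ Δ D hL hn h hσ ih =>
    simp only [KSub.comp, KSub.weaken, KSub.offset_snoc, key hσ hδ]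
    congr 1
    -- At offset zero, `δ.snoc u` is passed on whole and the weakening below must be cancelled as
    -- well. At a positive offset, truncation has already removed `u`.
    split_ifs with h0
    · subst h0
      rw [KSub.trunc_zero, KSub.trunc_zero]
      exact ih hδ
    · obtain ⟨k, rfl⟩ := Nat.exists_eq_succ_of_ne_zero h0
      rw [Nat.succ_eq_add_one, KSub.trunc_snoc]

theorem lift_comp_snoc_of (hc : SubComm L V V') (h : Wt L V γ Γ Δ) (hδ : Wt L V' δ Ψ Γ)
    {u : Exp} {S : Ty} (hu : V' → ∃ y, u = .var y) (du : Typing L Ψ u S) :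
    γ.lift.comp (δ.snoc u) = (γ.comp δ).snoc u := by
  rw [KSub.lift, KSub.snoc_comp, weaken_comp_snoc_of hc h hδ hu du]
  simp [Exp.sub, KSub.top_snoc]

/-- As `δ.lift` is `δ.weaken` extended by the new variable, this combines the cancellation law at
`δ.weaken` with `comp_weaken_of`. The type `S` is needed only to type that variable. -/
theorem lift_comp_lift_of (S : Ty) (hc : SubComm L V V') (h : Wt L V γ Γ Δ)
    (hδ : Wt L V' δ Ψ Γ) : γ.lift.comp δ.lift = (γ.comp δ).lift := by
  rw [KSub.lift.eq_def δ, lift_comp_snoc_of hc h (hδ.weaken S) (fun _ => ⟨0, rfl⟩)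
    (.var (T := S) .here), comp_weaken_of hc h hδ, KSub.lift]

end Wt

/-- Only the binder case needs `hc`, to compose the two lifted substitutions; the other cases follow
from truncation and lookup in a composite. -/
theorem Typing.sub_comp_of {V V' : Prop} (hc : Wt.SubComm L V V') {γ δ : KSub} {Γ Δ Ψ : Stack}
    {t : Exp} {T : Ty} (d : Typing L Δ t T) (h : Wt L V γ Γ Δ) (hδ : Wt L V' δ Ψ Γ) :
    t.sub (γ.comp δ) = (t.sub γ).sub δ := by
  induction d generalizing γ δ Γ Ψ with
  | var v =>
    have hx := v.lt_length
    rw [← h.top_length] at hx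
    rw [Exp.sub_var_of_lt hx, Exp.sub_var_of_lt (by simpa [KSub.top_comp] using hx)]
    simp [KSub.top_comp]
  | box d ih =>
    have := ih h.push hδ.push
    simp only [KSub.comp, KSub.trunc, KSub.offset, KSub.trunc_zero, KSub.offset_zero] at this
    simpa [Exp.sub] using this
  | unbox hL hn d ih =>
    simp only [Exp.sub]
    rw [KSub.offset_comp, KSub.trunc_comp, ih (h.trunc hn) (hδ.trunc (h.offset_lt hn))]
  | @lam Γ t S T d ih =>
    simp only [Exp.sub]
    rw [← Wt.lift_comp_lift_of S hc h hδ, ih (h.lift _) (hδ.lift _)]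
  | app d e ihd ihe => simp only [Exp.sub]; rw [ihd h hδ, ihe h hδ]

-- Bootstrapping the composition law from variables to terms

namespace Wt

theorem subComm_var (V : Prop) : SubComm L True V := by
  intro δ Γ Ψ t T ht d h
  obtain ⟨y, rfl⟩ := ht trivial
  cases d with
  | var v =>
    have hy : y < δ.top.length := by rw [h.top_length]; exact v.lt_length
    refine ⟨Exp.sub_weaken_var hy, fun u _ _ _ => ?_⟩
    simp [Exp.wk, Exp.shift, Exp.sub, KSub.top_snoc, hy]

/-- Weakening a term is substitution by `p(id⃗)`, so both identities reduce to composition laws with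
a renaming on one side: `δ` followed by `p(id⃗)`, supplied by `hc`, and `p(id⃗)` followed by `δ.snoc
u`, supplied by `subComm_var`. -/
theorem subComm_of {V' : Prop} (hc : SubComm L V' True) (V : Prop) : SubComm L V V' := by
  intro δ Γ Ψ t T _ d h
  constructor
  · obtain ⟨d'⟩ := d.nonempty_sub_wt h
    have hp := ((IsKWk.id L Ψ).p .base).wt True
    rw [d'.wk_eq, ← d.sub_comp_of hc h hp, comp_weaken_of hc h ((IsKWk.id L Ψ).wt True), h.comp_id]
  · intro u S hu du
    have hp := (IsKWk.id L Γ).wt True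
    rw [d.wk_eq, ← d.sub_comp_of (subComm_var V') (hp.weaken S) (h.snoc hu du),
      weaken_comp_snoc_of (subComm_var V') hp h hu du, h.id_comp]

/-- Two rounds of bootstrapping: variables under renamings give arbitrary terms under renamings,
which give arbitrary terms under arbitrary substitutions. -/
theorem subComm (V V' : Prop) : SubComm L V V' :=
  subComm_of (subComm_of (subComm_var True) V') V

variable {V V' : Prop} {γ δ σ : KSub} {Γ Δ Ψ : Stack}

theorem lift_comp_snoc (h : Wt L V γ Γ Δ) (hδ : Wt L False δ Ψ Γ) {u : Exp} {S : Ty}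
    (du : Typing L Ψ u S) : γ.lift.comp (δ.snoc u) = (γ.comp δ).snoc u :=
  lift_comp_snoc_of (subComm V False) h hδ False.elim du

end Wt

theorem Typing.sub_comp_wt {V V' : Prop} {γ δ : KSub} {Γ Δ Ψ : Stack} {t : Exp} {T : Ty}
    (d : Typing L Δ t T) (h : Wt L V γ Γ Δ) (hδ : Wt L V' δ Ψ Γ) :
    t.sub (γ.comp δ) = (t.sub γ).sub δ :=
  d.sub_comp_of (Wt.subComm V V') h hδ

/-- The new variable of `γ.lift` cancels the inner weakening, leaving `t[γ.weaken]`, from which the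
weakening is pulled out. -/
theorem Typing.wk_sub_lift {V : Prop} {γ : KSub} {Γ Δ : Stack} {t : Exp} {T : Ty}
    (d : Typing L Δ t T) (h : Wt L V γ Γ Δ) : t.wk.sub γ.lift = (t.sub γ).wk := by
  have hc := Wt.subComm (L := L) False V
  exact ((hc False.elim d (h.weaken .base)).2 _ .base (fun _ => ⟨0, rfl⟩) (.var .here)).trans
    (hc False.elim d h).1

/-! ### Judgmental equivalence -/

theorem Wt.id_ext {Γ : Stack} {n : ℕ} (hL : n ∈ L.UL) (hn : n < Γ.size) :
    Wt L False ((KSub.id (Γ.trunc n)).ext n []) Γ ((Γ.trunc n).push []) :=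
  .ext hL hn ((IsKWk.id L _).wt _) .nil

theorem Wt.id_snoc {Γ : Stack} {s : Exp} {S : Ty} (d : Typing L Γ s S) :
    Wt L False ((KSub.id Γ).snoc s) Γ (Γ.bind S) :=
  ((IsKWk.id L Γ).wt _).snoc False.elim d

theorem Typing.nonempty_modalTrans {Γ : Stack} {n : ℕ} {t : Exp} {T : Ty} (hL : n ∈ L.UL)
    (hn : n < Γ.size) (d : Typing L ((Γ.trunc n).push []) t T) :
    Nonempty (Typing L Γ (t.modalTrans (Γ.trunc n) n) T) :=
  d.nonempty_sub_wt (.id_ext hL hn)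

theorem Typing.nonempty_subst {Γ : Stack} {s t : Exp} {S T : Ty} (d : Typing L (Γ.bind S) t T)
    (e : Typing L Γ s S) : Nonempty (Typing L Γ (Exp.subst Γ s t) T) :=
  d.nonempty_sub_wt (.id_snoc e)

namespace TmEquiv

theorem refl {Γ : Stack} {t : Exp} {T : Ty} (d : Typing L Γ t T) : TmEquiv L Γ t t T := by
  induction d with
  | var v => exact .var v
  | box _ ih => exact .box ih
  | unbox hL hn _ ih => exact .unbox hL hn ih
  | lam _ ih => exact .lam ih
  | app _ _ ih ih' => exact .app ih ih'

/-- Both sides of a judgmental equivalence are well-typed. -/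
theorem nonempty_typing {Γ : Stack} {s t : Exp} {T : Ty} (h : TmEquiv L Γ s t T) :
    Nonempty (Typing L Γ s T) ∧ Nonempty (Typing L Γ t T) := by
  induction h with
  | symm _ ih => exact ih.symm
  | trans _ _ ih ih' => exact ⟨ih.1, ih'.2⟩
  | var v => exact ⟨⟨.var v⟩, ⟨.var v⟩⟩
  | box _ ih => exact ⟨ih.1.map .box, ih.2.map .box⟩
  | unbox hL hn _ ih => exact ⟨ih.1.map (.unbox hL hn), ih.2.map (.unbox hL hn)⟩
  | lam _ ih => exact ⟨ih.1.map .lam, ih.2.map .lam⟩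
  | app _ _ ih ih' =>
    exact ⟨ih.1.elim fun d => ih'.1.map d.app, ih.2.elim fun d => ih'.2.map d.app⟩
  | box_beta hL hn d => exact ⟨⟨.unbox hL hn (.box d)⟩, d.nonempty_modalTrans hL hn⟩
  | lam_beta d e => exact ⟨⟨.app (.lam d) e⟩, d.nonempty_subst e⟩
  | @box_eta Γ t T d =>
    exact ⟨⟨d⟩, ⟨.box (.unbox (Γ := Γ.push []) L.one_mem (Stack.one_lt_size_push _ _) d)⟩⟩
  | lam_eta d => exact ⟨⟨d⟩, (d.nonempty_wk _).map fun d' => .lam (.app d' (.var .here))⟩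

/-- Judgmental equivalence is closed under K-weakenings. -/
theorem sub {γ : KSub} {Γ Δ : Stack} {s t : Exp} {T : Ty} (e : TmEquiv L Δ s t T)
    (h : IsKWk L γ Γ Δ) : TmEquiv L Γ (s.sub γ) (t.sub γ) T := by
  induction e generalizing γ Γ with
  | symm _ ih => exact (ih h).symm
  | trans _ _ ih ih' => exact (ih h).trans (ih' h)
  | var v => exact ((Typing.var v).nonempty_sub h).elim refl
  | box _ ih =>
    exact .box (ih (.ext (Γ := Γ.push []) L.one_mem (Stack.one_lt_size_push _ _) h))
  | unbox hL hn _ ih => exact .unbox (h.offset_mem hn hL) (h.offset_lt hn) (ih (h.trunc hn))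
  | lam _ ih => exact .lam (ih (h.q _))
  | app _ _ ih ih' => exact .app (ih h) (ih' h)
  | @box_beta Δ n t T hL hn d =>
    have hγ := (h.trunc hn).wt False
    have hL' := h.offset_mem hn hL
    have hn' := h.offset_lt hn
    have e1 := d.sub_comp_wt (.id_ext hL hn) (h.wt False)
    have e2 := d.sub_comp_wt hγ.push (.id_ext hL' hn')
    -- Both composites equal `γ|n ; ⇑ᵏ ()` with `k` the offset of `γ` at `n`.
    have e3 : ((KSub.id (Δ.trunc n)).ext n []).comp γ =
        ((γ.trunc n).ext 1 []).comp ((KSub.id (Γ.trunc (γ.offset n))).ext (γ.offset n) []) := by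
      change KSub.ext _ _ _ =
        KSub.ext ((γ.trunc n).comp (KSub.trunc (KSub.id _) 0)) (_ + KSub.offset (KSub.id _) 0) _
      rw [hγ.id_comp, KSub.trunc_zero, hγ.comp_id, KSub.offset_zero]
      rfl
    rw [Exp.modalTrans, ← e1, e3, e2]
    exact .box_beta hL' hn' (d.nonempty_sub_wt hγ.push).some
  | @lam_beta Δ t s S T d e =>
    have hγ := h.wt False
    obtain ⟨e'⟩ := e.nonempty_sub_wt hγ
    -- Both composites equal `γ` extended by `s[γ]`.
    have e3 : ((KSub.id Δ).snoc s).comp γ = γ.lift.comp ((KSub.id Γ).snoc (s.sub γ)) := by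
      rw [KSub.snoc_comp, hγ.id_comp, hγ.lift_comp_snoc ((IsKWk.id L Γ).wt _) e', hγ.comp_id]
    rw [Exp.subst, ← d.sub_comp_wt (.id_snoc e) hγ, e3, d.sub_comp_wt (hγ.lift S) (.id_snoc e')]
    exact .lam_beta (d.nonempty_sub_wt (hγ.lift S)).some e'
  | box_eta d =>
    obtain ⟨d'⟩ := d.nonempty_sub h
    simp only [Exp.sub, KSub.offset, KSub.trunc, KSub.offset_zero, KSub.trunc_zero]
    exact .box_eta d'
  | lam_eta d =>
    obtain ⟨d'⟩ := d.nonempty_sub h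
    rw [Exp.sub, Exp.sub, d.wk_sub_lift (h.wt False)]
    simpa [Exp.sub, KSub.lift, KSub.top_snoc] using lam_eta d'

end TmEquiv

/-! ### The gluing relation -/

/-- The Kripke logical relation between terms and elements of the presheaf model. -/
def Glue (L : Logic) : (T : Ty) → (Γ : WkCat L) → Exp → (interpTy L T).obj (op Γ) → Prop
  | .base, Γ, t, a => TmEquiv L Γ t (show (Ne L .base).obj (op Γ) from a).1 .base
  | .box T, Γ, t, a => Nonempty (Typing L Γ t (.box T)) ∧ Glue L T (Γ.push []) (.unbox 1 t) a
  | .arr S T, Γ, t, a => Nonempty (Typing L Γ t (.arr S T)) ∧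
      ∀ (Δ : WkCat L) (γ : Δ ⟶ Γ) (s : Exp) (b : (interpTy L S).obj (op Δ)), Glue L S Δ s b →
        Glue L T Δ (.app (t.sub γ.1) s)
          (applyHom (F := interpTy L S) (G := interpTy L T) a γ.op b)

-- Invariance and monotonicity of gluing

namespace Glue

variable {Γ Δ : WkCat L} {t t' : Exp} {S T : Ty}

theorem nonempty_typing {a : (interpTy L T).obj (op Γ)} (h : Glue L T Γ t a) :
    Nonempty (Typing L Γ t T) := by
  cases T with
  | base => exact (TmEquiv.nonempty_typing h).1
  | box T => exact h.1
  | arr S T => exact h.1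

/-- The function case compares terms in a weakened world, which is where stability of `≈` under
K-weakenings is needed. -/
theorem congr {a : (interpTy L T).obj (op Γ)} (h : Glue L T Γ t a) (e : TmEquiv L Γ t t' T) :
    Glue L T Γ t' a := by
  induction T generalizing Γ t t' with
  | base => exact e.symm.trans h
  | box T ih =>
    exact ⟨e.nonempty_typing.2,
      ih h.2 (.unbox (Γ := Stack.push Γ []) L.one_mem (Stack.one_lt_size_push _ _) e)⟩
  | arr S T _ ih =>
    exact ⟨e.nonempty_typing.2, fun Δ γ s b hb =>
      ih (h.2 Δ γ s b hb) (.app (e.sub γ.2) (.refl hb.nonempty_typing.some))⟩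

/-- The function clause already quantifies over K-weakenings, so functoriality of substitution
suffices there. The box case uses `(unbox 1 t)[γ⃗;⇑¹] = unbox 1 (t[γ⃗])`. -/
theorem map {a : (interpTy L T).obj (op Γ)} (h : Glue L T Γ t a) (γ : Δ ⟶ Γ) :
    Glue L T Δ (t.sub γ.1) ((interpTy L T).map γ.op a) := by
  induction T generalizing Γ Δ t with
  | base => exact TmEquiv.sub h γ.2
  | box T ih =>
    refine ⟨h.1.elim fun d => d.nonempty_sub γ.2, ?_⟩
    have := ih h.2 ((WkCat.next L).map γ)
    change Glue L T (Δ.push []) (.unbox (1 + KSub.offset γ.1 0) (t.sub (KSub.trunc γ.1 0))) _ at this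
    rwa [KSub.offset_zero, KSub.trunc_zero] at this
  | arr S T _ ih =>
    obtain ⟨⟨d⟩, h⟩ := h
    refine ⟨d.nonempty_sub γ.2, fun Ψ δ s b hb => ?_⟩
    rw [← d.sub_comp γ.2 δ.2]
    exact h Ψ (δ ≫ γ) s b hb

end Glue

/-- Reflection maps a neutral term to an element related to it, and a term is equivalent to the
reification of each element related to it. -/
theorem glue_reflect_reify (T : Ty) :
    (∀ (Γ : WkCat L) (v : (Ne L T).obj (op Γ)), Glue L T Γ v.1 ((reflect L T).app (op Γ) v)) ∧
    ∀ (Γ : WkCat L) (t : Exp) (a : (interpTy L T).obj (op Γ)), Glue L T Γ t a →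
      TmEquiv L Γ t ((reify L T).app (op Γ) a).1 T := by
  -- The halves are mutually dependent: reflecting at a function type reifies the argument, and
  -- reifying there reflects the bound variable.
  induction T with
  | base => exact ⟨fun Γ v => TmEquiv.refl v.2.2.some, fun Γ t a h => h⟩
  | box T ih =>
    constructor
    · intro Γ v
      exact ⟨v.2.2, ih.1 (Γ.push []) ⟨.unbox 1 v.1, .unbox 1 v.2.1,
        v.2.2.map (.unbox (Γ := Γ.push []) L.one_mem (Stack.one_lt_size_push _ _))⟩⟩
    · intro Γ t a h
      exact (TmEquiv.box_eta h.1.some).trans (.box (ih.2 _ _ _ h.2))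
  | arr S T ihS ihT =>
    constructor
    · intro Γ v
      refine ⟨v.2.2, fun Δ γ s b hb => ?_⟩
      obtain ⟨d⟩ := v.2.2.some.nonempty_sub γ.2
      exact (ihT.1 Δ _).congr (.app (.refl d) (ihS.2 _ _ _ hb).symm)
    · intro Γ t a h
      obtain ⟨⟨d⟩, h⟩ := h
      -- Applying the function clause at `p(id⃗)` to the fresh variable yields the body of the
      -- η-expansion.
      have hx := h _ (Γ.pId S) _ _ (ihS.1 (Γ.bind S) (neVar Γ S))
      refine (TmEquiv.lam_eta d).trans (.lam ?_)
      rw [d.wk_eq]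
      exact ihT.2 _ _ _ hx

theorem glue_reflect (T : Ty) (Γ : WkCat L) (v : (Ne L T).obj (op Γ)) :
    Glue L T Γ v.1 ((reflect L T).app (op Γ) v) :=
  (glue_reflect_reify T).1 Γ v

theorem Glue.equiv_reify {T : Ty} {Γ : WkCat L} {t : Exp} {a : (interpTy L T).obj (op Γ)}
    (h : Glue L T Γ t a) : TmEquiv L Γ t ((reify L T).app (op Γ) a).1 T :=
  (glue_reflect_reify T).2 Γ t a h

-- Gluing of environments

/-- The gluing relation for local substitutions. -/
def GlueCtx (L : Logic) : (D : Ctx) → (Γ : WkCat L) → List Exp → (interpCtx L D).obj (op Γ) → Prop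
  | [], _, σ, _ => σ = []
  | T :: D, Γ, σ, ρ => ∃ t τ, σ = t :: τ ∧ Glue L T Γ t ρ.2 ∧ GlueCtx L D Γ τ ρ.1

/-- The gluing relation for K-substitutions. -/
def GlueEnv (L : Logic) : (b : List Ctx) → (D : Ctx) → (Γ : WkCat L) → KSub → Env ⟨b, D⟩ Γ → Prop
  | [], D, Γ, s, ρ => ∃ σ, s = .base σ ∧ GlueCtx L D Γ σ ρ.2
  | G :: Gs, D, Γ, s, ρ => ∃ s' σ, s = .ext s' ρ.1.1.1 σ ∧
      GlueEnv L Gs G (Γ.trunc ρ.1.1.1) s' ρ.1.2 ∧ GlueCtx L D Γ σ ρ.2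

theorem GlueCtx.wtLocal {D : Ctx} {Γ : WkCat L} {σ : List Exp} {ρ : (interpCtx L D).obj (op Γ)}
    (h : GlueCtx L D Γ σ ρ) : WtLocal L False σ Γ D := by
  induction D generalizing σ with
  | nil => obtain rfl : σ = [] := h; exact .nil
  | cons T D ih =>
    obtain ⟨t, τ, rfl, ht, hτ⟩ := h
    exact .cons ⟨False.elim, ht.nonempty_typing⟩ (ih hτ)

theorem GlueCtx.map {D : Ctx} {Γ Δ : WkCat L} {σ : List Exp} {ρ : (interpCtx L D).obj (op Γ)}
    (h : GlueCtx L D Γ σ ρ) (γ : Δ ⟶ Γ) :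
    GlueCtx L D Δ (σ.map fun t => t.sub γ.1) ((interpCtx L D).map γ.op ρ) := by
  induction D generalizing σ with
  | nil => obtain rfl : σ = [] := h; rfl
  | cons T D ih =>
    obtain ⟨t, τ, rfl, ht, hτ⟩ := h
    exact ⟨_, _, rfl, ht.map γ, ih hτ⟩

theorem GlueCtx.lookup {D : Ctx} {Γ : WkCat L} {σ : List Exp} {ρ : (interpCtx L D).obj (op Γ)}
    (h : GlueCtx L D Γ σ ρ) {x : ℕ} {T : Ty} (v : HasVar D x T) (u : Exp) :
    Glue L T Γ (σ.getD x u) ((lookup v).app (op Γ) ρ) := by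
  induction v generalizing σ with
  | here => obtain ⟨t, τ, rfl, ht, hτ⟩ := h; exact ht
  | there v ih => obtain ⟨t, τ, rfl, ht, hτ⟩ := h; exact ih hτ

namespace GlueEnv

variable {b : List Ctx} {D : Ctx} {Γ Δ : WkCat L} {s : KSub} {ρ : Env ⟨b, D⟩ Γ}

theorem top (h : GlueEnv L b D Γ s ρ) : GlueCtx L D Γ s.top ρ.2 := by
  cases b with
  | nil => obtain ⟨σ, rfl, h⟩ := h; exact h
  | cons G Gs => obtain ⟨s', σ, rfl, _, h⟩ := h; exact h

/-- The level conditions on the offsets are carried by the environment, and the typings come from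
gluing of the entries. -/
theorem wt (h : GlueEnv L b D Γ s ρ) : Wt L False s Γ ⟨b, D⟩ := by
  induction b generalizing D Γ s with
  | nil => obtain ⟨σ, rfl, h⟩ := h; exact .base h.wtLocal
  | cons G Gs ih =>
    obtain ⟨s', σ, rfl, h', h⟩ := h
    exact .ext (Δ := ⟨Gs, G⟩) ρ.1.1.2.1 ρ.1.1.2.2 (ih h') h.wtLocal

theorem map (h : GlueEnv L b D Γ s ρ) (γ : Δ ⟶ Γ) :
    GlueEnv L b D Δ (s.comp γ.1) ((interpStack L ⟨b, D⟩).map γ.op ρ) := by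
  induction b generalizing D Γ Δ s with
  | nil => obtain ⟨σ, rfl, h⟩ := h; exact ⟨_, rfl, h.map γ⟩
  | cons G Gs ih =>
    obtain ⟨s', σ, rfl, h', h⟩ := h
    exact ⟨_, _, rfl, ih h' (WkCat.truncHom γ ρ.1.1.1 ρ.1.1.2.2), h.map γ⟩

theorem snoc (h : GlueEnv L b D Γ s ρ) {t : Exp} {S : Ty} {a : (interpTy L S).obj (op Γ)}
    (ha : Glue L S Γ t a) :
    GlueEnv L b (S :: D) Γ (s.snoc t) (bindEnv (Γ := ⟨b, D⟩) ρ a) := by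
  cases b with
  | nil => obtain ⟨σ, rfl, h⟩ := h; exact ⟨_, rfl, _, _, rfl, ha, h⟩
  | cons G Gs => obtain ⟨s', σ, rfl, h', h⟩ := h; exact ⟨_, _, rfl, h', _, _, rfl, ha, h⟩

theorem push (h : GlueEnv L b D Γ s ρ) :
    GlueEnv L (D :: b) [] (Γ.push []) (s.ext 1 []) (extEnv (Γ := ⟨b, D⟩) ρ) :=
  ⟨_, _, rfl, h, rfl⟩

/-- Gluing forces the offsets of both sides to coincide, so `unbox` gets the same level in syntax
and semantics. -/
theorem offset_eq (h : GlueEnv L b D Γ s ρ) (n : ℕ) : s.offset n = envOffset n b D ρ := by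
  induction n generalizing b D Γ s with
  | zero => exact KSub.offset_zero s
  | succ n ih =>
    cases b with
    | nil => obtain ⟨σ, rfl, h⟩ := h; rfl
    | cons G Gs =>
      obtain ⟨s', σ, rfl, h', h⟩ := h
      exact congrArg (ρ.1.1.1 + ·) (ih h')

theorem trunc (h : GlueEnv L b D Γ s ρ) {n : ℕ} (hn : n < Stack.size ⟨b, D⟩) :
    GlueEnv L (Stack.trunc ⟨b, D⟩ n).below (Stack.trunc ⟨b, D⟩ n).top
      (Γ.trunc (envOffset n b D ρ)) (s.trunc n) (envTrunc n b D ρ) := by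
  induction n generalizing b D Γ s with
  | zero => rw [KSub.trunc_zero]; exact h
  | succ n ih =>
    cases b with
    | nil => simp [Stack.size] at hn
    | cons G Gs =>
      obtain ⟨s', σ, rfl, h', h⟩ := h
      -- `envTrunc` contains a cast, since iterated truncations of the world agree only
      -- propositionally; gluing is transported across it.
      have hc : ∀ (A B : WkCat L) (e : A = B) (r : Env (Stack.trunc ⟨Gs, G⟩ n) A),
          GlueEnv L _ _ A (s'.trunc n) r → GlueEnv L (Stack.trunc ⟨Gs, G⟩ n).below
            (Stack.trunc ⟨Gs, G⟩ n).top B (s'.trunc n)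
              (cast (congrArg (Env (L := L) (Stack.trunc ⟨Gs, G⟩ n)) e) r) := by
        rintro A _ rfl r hr
        exact hr
      exact hc _ _ (Stack.trunc_add Γ _ _).symm _ (ih h' (Nat.lt_of_succ_lt_succ hn))

end GlueEnv

/-- The fundamental lemma of the gluing relation. -/
theorem glue_eval {Γ : Stack} {t : Exp} {T : Ty} (d : Typing L Γ t T) {Δ : WkCat L} {s : KSub}
    {ρ : Env Γ Δ} (h : GlueEnv L Γ.below Γ.top Δ s ρ) :
    Glue L T Δ (t.sub s) ((eval d).app (op Δ) ρ) := by
  induction d generalizing Δ s with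
  | var v => exact h.top.lookup v _
  | @box Γ t T d ih =>
    obtain ⟨d'⟩ := d.nonempty_sub_wt h.wt.push
    refine ⟨⟨.box d'⟩, (ih h.push).congr ?_⟩
    -- At level 1 the modal transformation is substitution by the identity of `Δ;·`, so this β step
    -- returns the body itself.
    have e := TmEquiv.box_beta (Γ := Stack.push Δ []) L.one_mem (Stack.one_lt_size_push _ _) d'
    change TmEquiv L _ _ (Exp.sub _ (KSub.id (Stack.push Δ []))) _ at e
    rw [d'.sub_id] at e
    exact e.symm
  | @unbox Γ n t T hL hn d ih =>
    -- Transport along `id⃗;⇑ᵐ` turns the level-1 statement into one about `unbox m`, with `m` the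
    -- offset of the environment.
    have hs := (ih (h.trunc hn)).2.map
      (Δ.idExt _ (envOffset_mem n _ _ ρ hn hL) (envOffset_lt n _ _ ρ))
    obtain ⟨d'⟩ := d.nonempty_sub_wt (h.trunc hn).wt
    change Glue L T Δ (.unbox (envOffset n Γ.below Γ.top ρ + KSub.offset (KSub.id _) 0)
      (Exp.sub _ (KSub.trunc (KSub.id _) 0))) _ at hs
    rw [KSub.offset_zero, KSub.trunc_zero, d'.sub_id] at hs
    rw [Exp.sub, h.offset_eq n]
    exact hs
  | @lam Γ t S T d ih =>
    refine ⟨(Typing.lam d).nonempty_sub_wt h.wt, fun Ψ γ u b hb => ?_⟩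
    have hs := h.map γ
    obtain ⟨du⟩ := hb.nonempty_typing
    obtain ⟨d'⟩ := d.nonempty_sub_wt (h.wt.lift S)
    obtain ⟨d''⟩ := d'.nonempty_sub (γ.2.q S)
    refine (ih (hs.snoc hb)).congr ?_
    have e : TmEquiv L Ψ _ (((t.sub s.lift).sub (KSub.lift γ.1)).sub ((KSub.id Ψ).snoc u)) T :=
      TmEquiv.lam_beta d'' du
    -- The β-reduct is `t` under the composite of `s` with `γ`, extended by `u`: the substitution to
    -- which the induction hypothesis applies.
    have e1 : ((t.sub s.lift).sub (KSub.lift γ.1)).sub ((KSub.id Ψ).snoc u) =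
        t.sub ((s.comp γ.1).snoc u) := by
      rw [← d.sub_comp_wt (h.wt.lift S) ((γ.2.q S).wt False),
        Wt.lift_comp_lift_of S (Wt.subComm _ _) h.wt (γ.2.wt False),
        ← d.sub_comp_wt (hs.wt.lift S) (Wt.id_snoc du),
        hs.wt.lift_comp_snoc ((IsKWk.id L Ψ).wt _) du, hs.wt.comp_id]
    rw [e1] at e
    exact e.symm
  | app d e ihd ihe =>
    obtain ⟨d'⟩ := d.nonempty_sub_wt h.wt
    have := (ihd h).2 Δ (𝟙 Δ) _ _ (ihe h)
    change Glue L _ Δ (.app (Exp.sub _ (KSub.id Δ)) _) _ at this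
    rw [d'.sub_id] at this
    exact this

/-- The identity on an extended context is the weakened identity together with the new variable.
Monotonicity handles the former; reflection relates the latter to its interpretation. -/
theorem glueEnv_idEnvTop {b : List Ctx} {e : Env (L := L) ⟨b, []⟩ (⟨b, []⟩ : Stack)}
    (he : GlueEnv L b [] _ (KSub.id ⟨b, []⟩) e) (D : Ctx) :
    GlueEnv L b D (⟨b, D⟩ : Stack) (KSub.id ⟨b, D⟩) (idEnvTop b e D) := by
  induction D with
  | nil => exact he
  | cons T D ih =>
    have h := (ih.map (WkCat.pId (L := L) (⟨b, D⟩ : Stack) T)).snoc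
      (glue_reflect T _ (neVar (L := L) (⟨b, D⟩ : Stack) T))
    have e : (KSub.id ⟨b, D⟩).comp (WkCat.pId (L := L) (⟨b, D⟩ : Stack) T).1 =
        (KSub.id ⟨b, D⟩).weaken := ((IsKWk.id L _).p T).id_comp
    rw [e] at h
    exact (KSub.id_bind ⟨b, D⟩ T).symm ▸ h

theorem glueEnv_idEnvNil (b : List Ctx) :
    GlueEnv L b [] (⟨b, []⟩ : Stack) (KSub.id ⟨b, []⟩) (idEnvNil b) := by
  induction b with
  | nil => exact ⟨[], rfl, rfl⟩
  | cons G Gs ih => exact (glueEnv_idEnvTop ih G).push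

/-- The identity K-substitution is related to the identity environment. -/
theorem glueEnv_idEnv (Γ : Stack) : GlueEnv L Γ.below Γ.top Γ (KSub.id Γ) (idEnv L Γ) :=
  glueEnv_idEnvTop (glueEnv_idEnvNil Γ.below) Γ.top

end LamBox

theorem mainTheorem1 (L : LamBox.Logic) (Γ : LamBox.Stack) (t : LamBox.Exp) (T : LamBox.Ty)
    (d : LamBox.Typing L Γ t T) :
    LamBox.TmEquiv L Γ t (LamBox.nbe d).1 T := by
  have h := LamBox.glue_eval d (LamBox.glueEnv_idEnv Γ)
  rw [d.sub_id] at h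
  exact h.equiv_reify
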